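/- Model. A variational circuit $U(\theta)$ acts on $n$ qudits of local dimension $q\ge 2$, starting from $|0\rangle^{\otimes n}$. It contains entangling gates, arranged in $d$ layers of gates acting in parallel on disjoint pairs of (arbitrary, distinct) sites, such that every qudit is acted on by at least one entangling gate; the entangling gates are independent random elements of $\mathrm U(q^2)$, each distributed according to a probability measure that is a unitary 2-design. Each entangling gate may be preceded and succeeded by any number of parameterized gates acting on one or both of its two sites, of the form $W_l e^{-iA\theta_j}W_r$ with $A$ Hermitian, $e^{-iA\theta}$ of period $2\pi$ in $\theta$, and $W_l,W_r$ fixed unitaries; the parameters $\theta\in[0,2\pi]^p$ are drawn uniformly. Let $M_0=I,M_1,\dots,M_{q^2-1}\in\mathbb C^{q\times q}$ satisfy $\mathrm{tr}(M_i^\dagger M_j)=q\,\delta_{ij}$, and for $x\in\{0,\dots,q^2-1\}^n$ put $M_x=M_{x_1}\otimes\cdots\otimes M_{x_n}$, let $|x|$ be the number of nonzero entries of $x$, and $$g_x=\mathbb E_V\,\mathbb E_\theta\,\bigl|\langle 0^n|U(\theta)^\dagger M_xU(\theta)|0^n\rangle\bigr|^2 ,$$ where $\mathbb E_V$ averages over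 the entangling gates. The architecture is called $r$-regularly connected if for every nonempty proper subset $R$ of the qudits, any $r$ consecutive layers contain an entangling gate acting between $R$ and its complement (the least such $r$ is the regular connectivity). Claim. For every such circuit with entangling depth $d$ that is $r$-regularly connected, and every $x\ne 0$, $$g_x\le\Bigl(\frac{2q}{q+1}\Bigr)^n\Bigl(\frac{2q}{q^2+1}\Bigr)^{\lfloor d/r\rfloor}q^{-|x|}+(q^n+1)^{-1}.$$ Consequently, there are absolute constants $a,b>0$ (independent of $n,q,r,d,x$ and of the circuit) such that, with $d^*=a\,r\,n$, for every such circuit, every $x\ne0$ and $d>d^*$, $$g_x\le q^{-n}+q^{-b\,(d-d^*)/r-|x|}.$$ -/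

import Mathlib

open MeasureTheory

noncomputable section

namespace HEA

/-! ### The unitary group `U(q²)` and 2-designs -/

/-- Operators on two qudits of local dimension `q`. -/
abbrev TwoQuditOp (q : ℕ) : Type := Matrix (Fin q × Fin q) (Fin q × Fin q) ℂ

/-- The group `U(q²)` of unitaries on two qudits. -/
abbrev U2 (q : ℕ) : Type := Matrix.unitaryGroup (Fin q × Fin q) ℂ

instance instMeasurableSpaceU2 (q : ℕ) : MeasurableSpace (U2 q) := borel (U2 q)

instance instBorelSpaceU2 (q : ℕ) : BorelSpace (U2 q) := ⟨rfl⟩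

instance instCompactSpaceU2 (q : ℕ) : CompactSpace (U2 q) := by
  have hc : IsCompact (Set.univ.pi fun _ : Fin q × Fin q =>
      Set.univ.pi fun _ : Fin q × Fin q => Metric.closedBall (0 : ℂ) 1) :=
    isCompact_univ_pi fun _ => isCompact_univ_pi fun _ => isCompact_closedBall _ _
  have hcl : IsClosed {A : TwoQuditOp q | star A * A = 1 ∧ A * star A = 1} := by
    apply IsClosed.inter
    · exact isClosed_eq (by fun_prop) continuous_const
    · exact isClosed_eq (by fun_prop) continuous_const
  have hK : IsCompact {A : TwoQuditOp q | star A * A = 1 ∧ A * star A = 1} := by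
    refine IsCompact.of_isClosed_subset hc hcl ?_
    intro A hA i _ j _
    rw [mem_closedBall_zero_iff]
    exact entry_norm_bound_of_unitary (U := A) (Unitary.mem_iff.mpr hA) i j
  exact isCompact_iff_compactSpace.mp hK

/-- The normalized Haar measure on `U(q²)`. -/
def haarU2 (q : ℕ) : Measure (U2 q) := Measure.haarMeasure ⊤

/-- A probability measure on `U(q²)` is a (unitary) 2-design if all entries of
`𝔼[U ⊗ U ⊗ Ū ⊗ Ū]` agree with those of the Haar average. -/
structure IsTwoDesign {q : ℕ} (μ : Measure (U2 q)) : Prop where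
  isProbabilityMeasure : IsProbabilityMeasure μ
  moment_eq : ∀ a a' b b' c c' e e' : Fin q × Fin q,
    (∫ U : U2 q, U.1 a a' * U.1 b b' * star (U.1 c c') * star (U.1 e e') ∂μ) =
      ∫ U : U2 q, U.1 a a' * U.1 b b' * star (U.1 c c') * star (U.1 e e') ∂(haarU2 q)

/-! ### Operators on `n` qudits -/

/-- Operators on `n` qudits of local dimension `q`, as matrices in the computational basis. -/
abbrev QuditOp (n q : ℕ) : Type := Matrix (Fin n → Fin q) (Fin n → Fin q) ℂ

/-- The operator on `n` qudits acting as `A` on the (ordered) pair of sites `(i, j)` and as the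
identity on all other sites; used for `i ≠ j`. -/
def embed {n q : ℕ} (i j : Fin n) (A : TwoQuditOp q) : QuditOp n q :=
  Matrix.of fun a b =>
    if ∀ k, k ≠ i → k ≠ j → a k = b k then A (a i, a j) (b i, b j) else 0

/-- `M₀, …, M_{q²-1}` is an orthogonal operator basis: `M₀ = I` and `tr (Mᵢ† Mⱼ) = q δᵢⱼ`. -/
def IsOperatorBasis {q : ℕ} [NeZero q] (M : Fin (q ^ 2) → Matrix (Fin q) (Fin q) ℂ) : Prop :=
  M 0 = 1 ∧ ∀ i j, ((M i).conjTranspose * M j).trace = if i = j then (q : ℂ) else 0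

/-- `M_x = M_{x₁} ⊗ ⋯ ⊗ M_{xₙ}`. -/
def tensorOp {n q : ℕ} (M : Fin (q ^ 2) → Matrix (Fin q) (Fin q) ℂ) (x : Fin n → Fin (q ^ 2)) :
    QuditOp n q :=
  Matrix.of fun a b => ∏ i, M (x i) (a i) (b i)

/-! ### Circuit architectures -/

/-- The architecture of the entangling gates on `n` qudits: `m` entangling gates, listed in time
order, arranged in `d` layers of gates acting in parallel (on disjoint pairs of sites), such that
every qudit is acted on at least once. There is no geometric constraint on the pairs. -/
structure Architecture (n : ℕ) where
  /-- the number of entangling gates -/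
  m : ℕ
  /-- the entangling depth -/
  d : ℕ
  /-- the first site of each gate -/
  fst : Fin m → Fin n
  /-- the second site of each gate -/
  snd : Fin m → Fin n
  fst_ne_snd : ∀ k, fst k ≠ snd k
  /-- the layer of each gate -/
  layer : Fin m → Fin d
  layer_mono : Monotone layer
  layer_disjoint : ∀ k l, k ≠ l → layer k = layer l →
    Disjoint ({fst k, snd k} : Finset (Fin n)) {fst l, snd l}
  covers : ∀ i, ∃ k, i = fst k ∨ i = snd k

/-- The `k`-th gate acts between the set of sites `R` and its complement. -/
def Architecture.Crosses {n : ℕ} (C : Architecture n) (k : Fin C.m) (R : Finset (Fin n)) : Prop :=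
  (C.fst k ∈ R ∧ C.snd k ∉ R) ∨ (C.fst k ∉ R ∧ C.snd k ∈ R)

/-- `r`-regular connectivity: for every nonempty proper subset `R` of the qudits, any `r`
consecutive layers contain a gate acting between `R` and its complement. This property is monotone
in `r`; the least such `r` is the regular connectivity of the architecture. -/
def Architecture.IsRegularlyConnected {n : ℕ} (C : Architecture n) (r : ℕ) : Prop :=
  ∀ t : ℕ, t + r ≤ C.d → ∀ R : Finset (Fin n), R.Nonempty → R ≠ Finset.univ →
    ∃ k : Fin C.m, t ≤ (C.layer k : ℕ) ∧ (C.layer k : ℕ) < t + r ∧ C.Crosses k R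

/-! ### Variational circuits -/

/-- A parameterized gate `W_l e^{-iAθ} W_r` supported on a pair of sites (`A = A₁ ⊗ I` and so on
gives gates on a single site), with `A` Hermitian, `e^{-iAθ}` of period `2π` in `θ`, and `θ` the
parameter with index `param` among `p` parameters. -/
structure ParamGate (q p : ℕ) where
  A : TwoQuditOp q
  isHermitian : A.IsHermitian
  periodic : NormedSpace.exp ((-(2 * (Real.pi : ℂ) * Complex.I)) • A) = 1
  Wl : U2 q
  Wr : U2 q
  param : Fin p

/-- The matrix of a parameterized gate at the parameter values `θ`. -/
def ParamGate.toOp {q p : ℕ} (G : ParamGate q p) (θ : Fin p → ℝ) : TwoQuditOp q :=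
  G.Wl.1 * NormedSpace.exp ((-((θ G.param : ℂ) * Complex.I)) • G.A) * G.Wr.1

/-- The product of a list of parameterized gates, the head of the list acting first. -/
def paramProd {q p : ℕ} (L : List (ParamGate q p)) (θ : Fin p → ℝ) : TwoQuditOp q :=
  (L.map fun G => G.toOp θ).reverse.prod

/-- A variational circuit with `p` parameters: each entangling gate of the architecture is preceded
and succeeded by any number of parameterized gates acting on (one or both of) its sites. -/
structure VarCircuit (n q p : ℕ) extends Architecture n where
  /-- parameterized gates preceding each entangling gate -/
  pre : Fin m → List (ParamGate q p)
  /-- parameterized gates succeeding each entangling gate -/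
  post : Fin m → List (ParamGate q p)

variable {n q p : ℕ}

/-- The `k`-th entangling gate `V k` together with the parameterized gates attached to it. -/
def VarCircuit.block (C : VarCircuit n q p) (V : Fin C.m → U2 q) (θ : Fin p → ℝ) (k : Fin C.m) :
    QuditOp n q :=
  embed (C.fst k) (C.snd k) (paramProd (C.post k) θ * (V k).1 * paramProd (C.pre k) θ)

/-- The circuit `U(θ)` for the realization `V` of the entangling gates; the first block acts
first, so it is the rightmost factor. -/
def VarCircuit.U (C : VarCircuit n q p) (V : Fin C.m → U2 q) (θ : Fin p → ℝ) : QuditOp n q :=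
  (List.ofFn fun k => C.block V θ k).reverse.prod

/-- `⟨0ⁿ| U(θ)† M U(θ) |0ⁿ⟩`. -/
def VarCircuit.expVal [NeZero q] (C : VarCircuit n q p) (V : Fin C.m → U2 q) (θ : Fin p → ℝ)
    (M : QuditOp n q) : ℂ :=
  ((C.U V θ).conjTranspose * M * C.U V θ) (fun _ => 0) (fun _ => 0)

/-- `g_x = 𝔼_V 𝔼_θ |⟨0ⁿ| U(θ)† M_x U(θ) |0ⁿ⟩|²`, where the entangling gates are independent with
laws `μ k` and `θ` is uniform on `[0, 2π]^p`. -/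
def VarCircuit.g [NeZero q] (C : VarCircuit n q p) (μ : Fin C.m → Measure (U2 q))
    (M : Fin (q ^ 2) → Matrix (Fin q) (Fin q) ℂ) (x : Fin n → Fin (q ^ 2)) : ℝ :=
  ∫ V, (⨍ θ in Set.Icc (0 : Fin p → ℝ) (fun _ => 2 * Real.pi),
    ‖C.expVal V θ (tensorOp M x)‖ ^ 2) ∂(Measure.pi μ)

end HEA

end

/-!
The average of `X ↦ (U ⊗ U) X (U ⊗ U)†` over a 2-design is the Haar twirl, whose image is spanned
by the identity and the swap. So after every site has been hit once, the averaged circuit acts on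
product operators `⊗ᵢ P_{γ i}`, where `γ i` selects the identity or the swap on the two copies of
site `i`. A gate on sites `i, j` fixes such a state if `γ i = γ j`, and otherwise replaces it by
`q / (q² + 1)` times the sum of the two states in which the domain wall between `i` and `j` has
been removed. Regular connectivity forces every nonconstant `γ` to pay the factor `2q / (q² + 1)`
at least once in every `r` consecutive layers, so the trajectories that still have a domain wall
at the end give the first term of the bound. Since `M_x` with `x ≠ 0` has a traceless factor, the
all-identity state contributes nothing. The global flip of `γ` exchanges the weights reaching the
all-identity and the all-swap states, so conservation of the trace bounds the latter: this gives
`(qⁿ + 1)⁻¹`.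
-/

noncomputable section

namespace HEA

open scoped Kronecker Matrix

/-! ### Schur–Weyl duality for two copies -/

/-- Operators on two copies of a system with basis `ι`. -/
abbrev TwoCopyOp (ι : Type*) : Type _ := Matrix (ι × ι) (ι × ι) ℂ

section Commutant

variable {ι : Type*} [Fintype ι] [DecidableEq ι]

/-- `A ⊗ 1 + 1 ⊗ A`, the action of `A` as a derivation on two copies of a system. -/
def kroneckerSum : Matrix ι ι ℂ →ₗ[ℂ] TwoCopyOp ι where
  toFun A := A ⊗ₖ 1 + 1 ⊗ₖ A
  map_add' A B := by
    rw [Matrix.add_kronecker, Matrix.kronecker_add]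
    abel
  map_smul' z A := by
    rw [Matrix.smul_kronecker, Matrix.kronecker_smul, RingHom.id_apply, smul_add]

theorem kroneckerSum_mul_kroneckerSum (A B : Matrix ι ι ℂ) :
    kroneckerSum A * kroneckerSum B = kroneckerSum (A * B) + (A ⊗ₖ B + B ⊗ₖ A) := by
  simp only [kroneckerSum, LinearMap.coe_mk, AddHom.coe_mk, add_mul, mul_add,
    ← Matrix.mul_kronecker_mul, one_mul, mul_one]
  abel

theorem one_add_smul_mem_unitaryGroup {P : Matrix ι ι ℂ} (hP : IsStarProjection P) {z : ℂ}
    (hz : star z * z = 1) : 1 + (z - 1) • P ∈ Matrix.unitaryGroup ι ℂ := by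
  rw [Matrix.mem_unitaryGroup_iff', star_add, star_one, star_smul, hP.isSelfAdjoint.star_eq,
    add_mul, mul_add, one_mul, one_mul, mul_add, mul_one, smul_mul_smul_comm,
    hP.isIdempotentElem.eq, add_assoc, ← add_smul, ← add_smul, star_sub, star_one]
  rw [show z - 1 + (star z - 1 + (star z - 1) * (z - 1)) = star z * z - 1 by ring, hz, sub_self,
    zero_smul, add_zero]

omit [Fintype ι] in
theorem one_add_smul_kronecker_self (P : Matrix ι ι ℂ) (z : ℂ) :
    (1 + z • P) ⊗ₖ (1 + z • P) = 1 + z • kroneckerSum P + z ^ 2 • P ⊗ₖ P := by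
  simp only [kroneckerSum, LinearMap.coe_mk, AddHom.coe_mk, Matrix.add_kronecker,
    Matrix.kronecker_add, Matrix.smul_kronecker, Matrix.kronecker_smul, Matrix.one_kronecker_one,
    smul_smul, smul_add]
  module

variable {X : TwoCopyOp ι}

-- The unitaries `1 - 2 P` and `1 + (i - 1) P` suffice to isolate the term of first order in `P`.
theorem commute_kroneckerSum_of_isStarProjection
    (hX : ∀ U ∈ Matrix.unitaryGroup ι ℂ, Commute X (U ⊗ₖ U)) {P : Matrix ι ι ℂ}
    (hP : IsStarProjection P) : Commute X (kroneckerSum P) := by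
  have hcomm : ∀ z : ℂ, star z * z = 1 →
      Commute X ((z - 1) • kroneckerSum P + (z - 1) ^ 2 • P ⊗ₖ P) := fun z hz => by
    have h := hX _ (one_add_smul_mem_unitaryGroup hP hz)
    rw [one_add_smul_kronecker_self, add_assoc] at h
    simpa using h.sub_right (Commute.one_right X)
  have hneg := hcomm (-1) (by simp)
  have hI := hcomm Complex.I (by simp)
  have hfirst : kroneckerSum P = (-(1 / 2) : ℂ) •
      (Complex.I • ((-1 - 1 : ℂ) • kroneckerSum P + (-1 - 1 : ℂ) ^ 2 • P ⊗ₖ P) +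
        (2 : ℂ) • ((Complex.I - 1) • kroneckerSum P + (Complex.I - 1) ^ 2 • P ⊗ₖ P)) := by
    have hsq : (Complex.I - 1) ^ 2 = -2 * Complex.I := by
      rw [sub_sq, Complex.I_sq]
      ring
    rw [hsq]
    module
  rw [hfirst]
  exact ((hneg.smul_right _).add_right (hI.smul_right _)).smul_right _

theorem isStarProjection_single (k : ι) : IsStarProjection (Matrix.single k k (1 : ℂ)) where
  isIdempotentElem := by simp [IsIdempotentElem]
  isSelfAdjoint := by
    rw [isSelfAdjoint_iff, Matrix.star_eq_conjTranspose, Matrix.conjTranspose_single, star_one]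

omit [DecidableEq ι] in
theorem exists_eq_sum_smul_isStarProjection {A : Matrix ι ι ℂ} (hA : A.IsHermitian) :
    ∃ (c : ι → ℂ) (P : ι → Matrix ι ι ℂ), (∀ k, IsStarProjection (P k)) ∧
      A = ∑ k, c k • P k := by
  classical
  let φ := Unitary.conjStarAlgAut ℂ (Matrix ι ι ℂ) hA.eigenvectorUnitary
  refine ⟨fun k => hA.eigenvalues k, fun k => φ (Matrix.single k k 1),
    fun k => (isStarProjection_single k).map φ, ?_⟩
  have hdiag : Matrix.diagonal (RCLike.ofReal ∘ hA.eigenvalues) =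
      ∑ k, (hA.eigenvalues k : ℂ) • Matrix.single k k (1 : ℂ) := by
    ext a b
    simp [Matrix.sum_apply, Matrix.diagonal_apply, Matrix.single_apply, ite_and]
  conv_lhs => rw [hA.spectral_theorem, hdiag, map_sum]
  simp only [map_smul, φ]

theorem commute_kroneckerSum (hX : ∀ U ∈ Matrix.unitaryGroup ι ℂ, Commute X (U ⊗ₖ U))
    (A : Matrix ι ι ℂ) : Commute X (kroneckerSum A) := by
  have hherm : ∀ B : Matrix ι ι ℂ, B.IsHermitian → Commute X (kroneckerSum B) := fun B hB => by
    obtain ⟨c, P, hP, rfl⟩ := exists_eq_sum_smul_isStarProjection hB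
    simp only [map_sum, map_smul]
    exact Commute.sum_right _ _ _ fun k _ =>
      (commute_kroneckerSum_of_isStarProjection hX (hP k)).smul_right _
  rw [← realPart_add_I_smul_imaginaryPart A, map_add, map_smul]
  exact (hherm _ (realPart A).2).add_right ((hherm _ (imaginaryPart A).2).smul_right _)

theorem commute_kronecker_add_kronecker
    (hX : ∀ U ∈ Matrix.unitaryGroup ι ℂ, Commute X (U ⊗ₖ U)) (A B : Matrix ι ι ℂ) :
    Commute X (A ⊗ₖ B + B ⊗ₖ A) := by
  have h := ((commute_kroneckerSum hX A).mul_right (commute_kroneckerSum hX B)).sub_right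
    (commute_kroneckerSum hX (A * B))
  rwa [kroneckerSum_mul_kroneckerSum, add_sub_cancel_left] at h

/-- The operator permuting the two copies of a system: the identity for `false`, the swap for
`true`. -/
def copyPerm : Bool → TwoCopyOp ι
  | false => 1
  | true => (1 : TwoCopyOp ι).submatrix id Prod.swap

omit [Fintype ι] in
theorem copyPerm_apply (s : Bool) (a b c e : ι) :
    copyPerm s (a, b) (c, e) =
      if s then if a = e ∧ b = c then 1 else 0 else if a = c ∧ b = e then 1 else 0 := by
  cases s <;> simp [copyPerm, Matrix.one_apply]

theorem exists_eq_sum_smul_copyPerm [Nontrivial ι]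
    (hX : ∀ U ∈ Matrix.unitaryGroup ι ℂ, Commute X (U ⊗ₖ U)) :
    ∃ c : Bool → ℂ, X = ∑ s, c s • copyPerm s := by
  obtain ⟨i, j, hij⟩ := exists_pair_ne ι
  refine ⟨fun s => if s then X (j, i) (i, j) else X (i, j) (i, j), ?_⟩
  ext ⟨a, b⟩ ⟨c, e⟩
  have h := congrFun₂ (commute_kronecker_add_kronecker hX (Matrix.single c i 1)
    (Matrix.single e j 1)).eq (a, b) (i, j)
  have hne : (i, j) ≠ (j, i) := fun h => hij (Prod.ext_iff.mp h).1
  simp only [mul_add, add_mul, Matrix.add_apply, Matrix.single_kronecker_single, mul_one,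
    Matrix.mul_single_apply_same, Matrix.mul_single_apply_of_ne (hbj := hne), add_zero] at h
  rw [h]
  simp [copyPerm_apply, Matrix.mul_apply, Matrix.single_apply, ite_and, eq_comm (b := a),
    eq_comm (b := b), add_comm]

end Commutant

/-! ### The Haar twirl on two copies -/

section TwoCopy

variable {ι : Type*} [Fintype ι] [DecidableEq ι]

theorem copyPerm_mul_copyPerm (s t : Bool) :
    copyPerm s * copyPerm t = (copyPerm (s ^^ t) : TwoCopyOp ι) := by
  ext ⟨a, b⟩ ⟨c, e⟩
  cases s <;> cases t <;> simp [copyPerm, Matrix.mul_apply, Matrix.one_apply]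

theorem commute_copyPerm_kronecker_self (s : Bool) (A : Matrix ι ι ℂ) :
    Commute (copyPerm s) (A ⊗ₖ A) := by
  cases s
  · exact Commute.one_left _
  · ext ⟨a, b⟩ ⟨c, e⟩
    simp [Matrix.mul_apply, copyPerm_apply, Fintype.sum_prod_type, ite_and, mul_comm]

/-- The contraction `tr (π X)` of a two-copy operator `X` with a permutation `π` of the copies. -/
def contract (s : Bool) : TwoCopyOp ι →ₗ[ℂ] ℂ :=
  Matrix.traceLinearMap (ι × ι) ℂ ℂ ∘ₗ LinearMap.mulLeft ℂ (copyPerm s)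

theorem contract_apply (s : Bool) (X : TwoCopyOp ι) :
    contract s X = (copyPerm s * X).trace := rfl

theorem contract_false_kronecker (A B : Matrix ι ι ℂ) :
    contract false (A ⊗ₖ B) = A.trace * B.trace := by
  rw [contract_apply, copyPerm, one_mul, Matrix.trace_kronecker]

theorem contract_true_kronecker (A B : Matrix ι ι ℂ) :
    contract true (A ⊗ₖ B) = (A * B).trace := by
  rw [Matrix.trace_mul_comm]
  simp [contract_apply, Matrix.trace, Matrix.mul_apply, copyPerm_apply, Fintype.sum_prod_type,
    ite_and, mul_comm]

theorem contract_copyPerm (s t : Bool) :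
    contract s (copyPerm t : TwoCopyOp ι) =
      if s = t then (Fintype.card ι : ℂ) ^ 2 else Fintype.card ι := by
  rw [contract_apply, copyPerm_mul_copyPerm]
  cases s <;> cases t <;> simp [Matrix.trace, copyPerm_apply, Fintype.sum_prod_type, sq, ite_and]

/-- Conjugation of two-copy operators by `W ⊗ W`. -/
def twoCopyConj : Matrix ι ι ℂ →* (TwoCopyOp ι →L[ℂ] TwoCopyOp ι) where
  toFun W := LinearMap.toContinuousLinearMap (LinearMap.mulLeftRight ℂ (W ⊗ₖ W, (W ⊗ₖ W)ᴴ))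
  map_one' := by
    ext1 X
    simp
  map_mul' U W := by
    ext1 X
    simp [Matrix.mul_kronecker_mul, Matrix.conjTranspose_mul, mul_assoc]

theorem twoCopyConj_apply (W : Matrix ι ι ℂ) (X : TwoCopyOp ι) :
    twoCopyConj W X = (W ⊗ₖ W) * X * (W ⊗ₖ W)ᴴ := rfl

theorem conjTranspose_kronecker_self_mul {U : Matrix ι ι ℂ} (hU : U ∈ Matrix.unitaryGroup ι ℂ) :
    (U ⊗ₖ U)ᴴ * (U ⊗ₖ U) = 1 :=
  Matrix.mem_unitaryGroup_iff'.mp (Matrix.kronecker_mem_unitary hU hU)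

theorem kronecker_self_mul_conjTranspose {U : Matrix ι ι ℂ} (hU : U ∈ Matrix.unitaryGroup ι ℂ) :
    (U ⊗ₖ U) * (U ⊗ₖ U)ᴴ = 1 :=
  Matrix.mem_unitaryGroup_iff.mp (Matrix.kronecker_mem_unitary hU hU)

theorem contract_twoCopyConj {U : Matrix ι ι ℂ} (hU : U ∈ Matrix.unitaryGroup ι ℂ) (s : Bool)
    (X : TwoCopyOp ι) : contract s (twoCopyConj U X) = contract s X := by
  rw [contract_apply, contract_apply, twoCopyConj_apply, ← mul_assoc, ← mul_assoc,
    (commute_copyPerm_kronecker_self s U).eq, Matrix.trace_mul_comm, mul_assoc, ← mul_assoc,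
    conjTranspose_kronecker_self_mul hU, one_mul]

theorem twoCopyConj_copyPerm {U : Matrix ι ι ℂ} (hU : U ∈ Matrix.unitaryGroup ι ℂ) (s : Bool) :
    twoCopyConj U (copyPerm s) = copyPerm s := by
  rw [twoCopyConj_apply, ← (commute_copyPerm_kronecker_self s U).eq, mul_assoc,
    kronecker_self_mul_conjTranspose hU, mul_one]

theorem commute_kronecker_self_of_twoCopyConj_eq {U : Matrix ι ι ℂ}
    (hU : U ∈ Matrix.unitaryGroup ι ℂ) {X : TwoCopyOp ι}
    (hX : twoCopyConj U X = X) : Commute X (U ⊗ₖ U) := by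
  rw [commute_iff_eq]
  nth_rw 1 [← hX]
  rw [twoCopyConj_apply, mul_assoc, conjTranspose_kronecker_self_mul hU, mul_one]

/-- The coefficient of a permutation of the copies in the Haar twirl of a two-copy operator in
dimension `D`, where `x` and `y` are the contractions of the operator with this and with the other
permutation. -/
def weingarten (D x y : ℂ) : ℂ := (D * x - y) / (D * (D ^ 2 - 1))

/-- The Haar twirl `∫ (U ⊗ U) X (U ⊗ U)ᴴ dU` in closed form. -/
def twirl (X : TwoCopyOp ι) : TwoCopyOp ι :=
  ∑ s, weingarten (Fintype.card ι) (contract s X) (contract (!s) X) • copyPerm s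

theorem twirl_congr {X Y : TwoCopyOp ι} (h : ∀ s, contract s X = contract s Y) :
    twirl X = twirl Y := by
  simp only [twirl, h]

theorem twirl_eq_self [Nontrivial ι] {X : TwoCopyOp ι}
    (hX : ∀ U ∈ Matrix.unitaryGroup ι ℂ, twoCopyConj U X = X) : twirl X = X := by
  obtain ⟨c, rfl⟩ := exists_eq_sum_smul_copyPerm fun U hU =>
    commute_kronecker_self_of_twoCopyConj_eq hU (hX U hU)
  have hD : (Fintype.card ι : ℂ) ≠ 0 := Nat.cast_ne_zero.mpr Fintype.card_ne_zero
  have hD' : (Fintype.card ι : ℂ) ^ 2 - 1 ≠ 0 := by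
    rw [sub_ne_zero]
    exact_mod_cast (Nat.one_lt_pow two_ne_zero Fintype.one_lt_card).ne'
  refine Finset.sum_congr rfl fun s _ => ?_
  congr 1
  simp only [Fintype.sum_bool, map_add, map_smul, contract_copyPerm, weingarten, smul_eq_mul]
  cases s <;> simp <;> field_simp <;> ring

theorem twoCopyConj_twirl {U : Matrix ι ι ℂ} (hU : U ∈ Matrix.unitaryGroup ι ℂ)
    (X : TwoCopyOp ι) : twoCopyConj U (twirl X) = twirl X := by
  simp only [twirl, map_sum, map_smul, twoCopyConj_copyPerm hU]

end TwoCopy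

/-! ### Averages over 2-designs -/

section Integration

theorem integrable_of_continuous {α E : Type*} [TopologicalSpace α] [CompactSpace α]
    [MeasurableSpace α] [OpensMeasurableSpace α] [NormedAddCommGroup E] {μ : Measure α}
    [IsFiniteMeasureOnCompacts μ] {f : α → E} (hf : Continuous f) : Integrable f μ :=
  hf.integrable_of_hasCompactSupport (HasCompactSupport.of_compactSpace f)

theorem integrable_and_integral_pi_list_prod {𝔸 : Type*} [NormedRing 𝔸] [NormedAlgebra ℝ 𝔸]
    [CompleteSpace 𝔸] {Ω : Type*} [MeasurableSpace Ω] {m : ℕ} {μ : Fin m → Measure Ω}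
    [∀ k, IsProbabilityMeasure (μ k)] {F : Fin m → Ω → 𝔸} (hF : ∀ k, Integrable (F k) (μ k)) :
    Integrable (fun V => (List.ofFn fun k => F k (V k)).reverse.prod) (Measure.pi μ) ∧
      ∫ V, (List.ofFn fun k => F k (V k)).reverse.prod ∂Measure.pi μ =
        (List.ofFn fun k => ∫ V, F k V ∂μ k).reverse.prod := by
  induction m with
  | zero => simp
  | succ m ih =>
    obtain ⟨hint, heq⟩ := ih fun k => hF k.succ
    have hmp := measurePreserving_piFinSuccAbove μ 0
    simp only [List.ofFn_succ, List.reverse_cons, List.prod_append, List.prod_singleton]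
    refine ⟨hmp.integrable_comp_of_integrable (hint.mul_prod (hF 0)).swap, ?_⟩
    rw [← heq]
    exact (hmp.integral_comp (MeasurableEquiv.measurableEmbedding _) _).trans
      (integral_prod_bilin (ContinuousLinearMap.mul ℝ 𝔸).flip (hF 0) hint)

end Integration

section TwoDesign

open scoped Matrix.Norms.L2Operator

instance (q : ℕ) : IsProbabilityMeasure (haarU2 q) := ⟨Measure.haarMeasure_self⟩

instance (q : ℕ) : (haarU2 q).IsMulLeftInvariant := Measure.isMulLeftInvariant_haarMeasure ⊤

theorem continuous_twoCopyConj {ι : Type*} [Fintype ι] [DecidableEq ι] :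
    Continuous (twoCopyConj : Matrix ι ι ℂ → _) := by
  refine continuous_clm_apply.mpr fun X => ?_
  have hW : Continuous fun W : Matrix ι ι ℂ => W ⊗ₖ W :=
    continuous_matrix fun a b =>
      (continuous_id.matrix_elem a.1 b.1).mul (continuous_id.matrix_elem a.2 b.2)
  exact (hW.matrix_mul continuous_const).matrix_mul hW.matrix_conjTranspose

variable {q : ℕ}

theorem integrable_twoCopyConj {α ι : Type*} [TopologicalSpace α] [CompactSpace α]
    [MeasurableSpace α] [OpensMeasurableSpace α] {μ : Measure α} [IsFiniteMeasureOnCompacts μ]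
    [Fintype ι] [DecidableEq ι] {W : α → Matrix ι ι ℂ} (hW : Continuous W) :
    Integrable (fun V => twoCopyConj (W V)) μ :=
  integrable_of_continuous (E := TwoCopyOp ι →L[ℂ] TwoCopyOp ι) (continuous_twoCopyConj.comp hW)

theorem integral_twoCopyConj_apply_apply (μ : Measure (U2 q)) [IsFiniteMeasureOnCompacts μ]
    (X : TwoCopyOp (Fin q × Fin q))
    (a b : (Fin q × Fin q) × (Fin q × Fin q)) :
    (∫ V : U2 q, twoCopyConj V.1 ∂μ) X a b = ∫ V : U2 q, twoCopyConj V.1 X a b ∂μ := by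
  have hint := integrable_twoCopyConj (μ := μ) continuous_subtype_val
  rw [ContinuousLinearMap.integral_apply hint X]
  exact ((LinearMap.toContinuousLinearMap (Matrix.entryLinearMap ℂ ℂ a b)).integral_comp_comm
    (hint.apply_continuousLinearMap X)).symm

theorem twoCopyConj_single_apply {ι : Type*} [Fintype ι] [DecidableEq ι] (W : Matrix ι ι ℂ)
    (a b c e : ι × ι) :
    twoCopyConj W (Matrix.single c e 1) a b =
      W a.1 c.1 * W a.2 c.2 * star (W b.1 e.1) * star (W b.2 e.2) := by
  simp [twoCopyConj_apply, Matrix.mul_apply, Matrix.single_apply, ite_and, mul_assoc]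

theorem IsTwoDesign.integral_twoCopyConj_eq {μ : Measure (U2 q)} (hμ : IsTwoDesign μ) :
    ∫ V : U2 q, twoCopyConj V.1 ∂μ = ∫ V : U2 q, twoCopyConj V.1 ∂haarU2 q := by
  have := hμ.isProbabilityMeasure
  refine ContinuousLinearMap.coe_injective (Matrix.ext_linearMap ℂ fun c e => ?_)
  ext a b
  simpa [integral_twoCopyConj_apply_apply, twoCopyConj_single_apply] using
    hμ.moment_eq a.1 c.1 a.2 c.2 b.1 e.1 b.2 e.2

theorem integral_haarU2_twoCopyConj_apply [Nontrivial (Fin q)]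
    (X : TwoCopyOp (Fin q × Fin q)) :
    (∫ V : U2 q, twoCopyConj V.1 ∂haarU2 q) X = twirl X := by
  have hint := integrable_twoCopyConj (μ := haarU2 q) continuous_subtype_val
  have hinv (U : U2 q) : twoCopyConj U.1 ((∫ V : U2 q, twoCopyConj V.1 ∂haarU2 q) X) =
      (∫ V : U2 q, twoCopyConj V.1 ∂haarU2 q) X := by
    rw [ContinuousLinearMap.integral_apply hint,
      ← ContinuousLinearMap.integral_comp_comm _ (hint.apply_continuousLinearMap X)]
    simp only [← mul_apply_eq_comp, ← map_mul]
    exact integral_mul_left_eq_self (fun V : U2 q => twoCopyConj V.1 X) U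
  have hcontract (s : Bool) : contract s ((∫ V : U2 q, twoCopyConj V.1 ∂haarU2 q) X) =
      contract s X := by
    rw [ContinuousLinearMap.integral_apply hint]
    refine ((LinearMap.toContinuousLinearMap (contract s)).integral_comp_comm
      (hint.apply_continuousLinearMap X)).symm.trans ?_
    simp [contract_twoCopyConj]
  rw [← twirl_eq_self fun U hU => hinv ⟨U, hU⟩]
  exact twirl_congr hcontract

theorem IsTwoDesign.integral_twoCopyConj_apply [Nontrivial (Fin q)] {μ : Measure (U2 q)}
    (hμ : IsTwoDesign μ) {A B : TwoQuditOp q} (hA : A ∈ Matrix.unitaryGroup (Fin q × Fin q) ℂ)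
    (hB : B ∈ Matrix.unitaryGroup (Fin q × Fin q) ℂ)
    (X : TwoCopyOp (Fin q × Fin q)) :
    (∫ V : U2 q, twoCopyConj (A * V.1 * B) ∂μ) X = twirl X := by
  have := hμ.isProbabilityMeasure
  have hint := integrable_twoCopyConj (μ := μ) continuous_subtype_val
  have hY : ∫ V : U2 q, twoCopyConj V.1 (twoCopyConj B X) ∂μ = twirl (twoCopyConj B X) := by
    rw [← ContinuousLinearMap.integral_apply hint, hμ.integral_twoCopyConj_eq,
      integral_haarU2_twoCopyConj_apply]
  have hAB : Continuous fun V : U2 q => A * V.1 * B := by fun_prop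
  rw [ContinuousLinearMap.integral_apply (integrable_twoCopyConj hAB)]
  simp only [map_mul]
  refine ((twoCopyConj A).integral_comp_comm
    (hint.apply_continuousLinearMap (twoCopyConj B X))).trans ?_
  rw [hY, twoCopyConj_twirl hA]
  exact twirl_congr fun s => contract_twoCopyConj hB s X

end TwoDesign

/-! ### Product operators and gates on a pair of sites -/

section TensorProduct

variable {α β : Type*}

/-- The tensor product of two-copy operators on two systems, as a two-copy operator on the joint
system. -/
def twoCopyTensor : TwoCopyOp α →ₗ[ℂ] TwoCopyOp β →ₗ[ℂ] TwoCopyOp (α × β) :=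
  LinearMap.mk₂ ℂ (fun Y Z => (Y ⊗ₖ Z).submatrix (Equiv.prodProdProdComm α β α β)
      (Equiv.prodProdProdComm α β α β))
    (fun _ _ _ => by rw [Matrix.add_kronecker]; rfl)
    (fun _ _ _ => by rw [Matrix.smul_kronecker]; rfl)
    (fun _ _ _ => by rw [Matrix.kronecker_add]; rfl)
    (fun _ _ _ => by rw [Matrix.kronecker_smul]; rfl)

theorem twoCopyTensor_apply (Y : TwoCopyOp α) (Z : TwoCopyOp β) (a b c e : α × β) :
    twoCopyTensor Y Z (a, b) (c, e) = Y (a.1, b.1) (c.1, e.1) * Z (a.2, b.2) (c.2, e.2) := rfl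

theorem twoCopyTensor_copyPerm [DecidableEq α] [DecidableEq β] (s : Bool) :
    twoCopyTensor (copyPerm s : TwoCopyOp α) (copyPerm s : TwoCopyOp β) = copyPerm s := by
  ext ⟨a, b⟩ ⟨c, e⟩
  rw [twoCopyTensor_apply]
  cases s <;> simp [copyPerm_apply, Prod.ext_iff, ← ite_and, and_assoc, and_comm, and_left_comm]

theorem twoCopyTensor_kronecker (A B : Matrix α α ℂ) (C D : Matrix β β ℂ) :
    twoCopyTensor (A ⊗ₖ B) (C ⊗ₖ D) = (A ⊗ₖ C) ⊗ₖ (B ⊗ₖ D) := by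
  ext ⟨a, b⟩ ⟨c, e⟩
  exact mul_mul_mul_comm _ _ _ _

variable [Fintype α] [Fintype β]

theorem twoCopyTensor_mul (Y Y' : TwoCopyOp α) (Z Z' : TwoCopyOp β) :
    twoCopyTensor (Y * Y') (Z * Z') = twoCopyTensor Y Z * twoCopyTensor Y' Z' :=
  (congrArg (Matrix.submatrix · _ _) (Matrix.mul_kronecker_mul Y Y' Z Z')).trans
    (Matrix.submatrix_mul_equiv _ _ _ _ _).symm

theorem trace_twoCopyTensor (Y : TwoCopyOp α) (Z : TwoCopyOp β) :
    (twoCopyTensor Y Z).trace = Y.trace * Z.trace := by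
  rw [← Matrix.trace_kronecker]
  exact Equiv.sum_comp (Equiv.prodProdProdComm α β α β) fun a => (Y ⊗ₖ Z) a a

variable [DecidableEq α] [DecidableEq β]

theorem contract_twoCopyTensor (s : Bool) (Y : TwoCopyOp α) (Z : TwoCopyOp β) :
    contract s (twoCopyTensor Y Z) = contract s Y * contract s Z := by
  rw [contract_apply, ← twoCopyTensor_copyPerm, ← twoCopyTensor_mul, trace_twoCopyTensor]
  rfl

theorem twoCopyConj_kronecker_twoCopyTensor (A : Matrix α α ℂ) (B : Matrix β β ℂ)
    (Y : TwoCopyOp α) (Z : TwoCopyOp β) :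
    twoCopyConj (A ⊗ₖ B) (twoCopyTensor Y Z) =
      twoCopyTensor (twoCopyConj A Y) (twoCopyConj B Z) := by
  simp only [twoCopyConj_apply, twoCopyTensor_mul, Matrix.conjTranspose_kronecker,
    twoCopyTensor_kronecker]

theorem twoCopyConj_submatrix (e : β ≃ α) (A : Matrix α α ℂ) (X : TwoCopyOp α) :
    twoCopyConj (A.submatrix e e) (X.submatrix (Prod.map e e) (Prod.map e e)) =
      (twoCopyConj A X).submatrix (Prod.map e e) (Prod.map e e) := by
  have hkron : A.submatrix e e ⊗ₖ A.submatrix e e =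
      (A ⊗ₖ A).submatrix (e.prodCongr e) (e.prodCongr e) := rfl
  rw [twoCopyConj_apply, hkron, Matrix.conjTranspose_submatrix]
  exact (congrArg (· * _) (Matrix.submatrix_mul_equiv _ _ _ (e.prodCongr e) _)).trans
    (Matrix.submatrix_mul_equiv _ _ _ (e.prodCongr e) _)

end TensorProduct

section ProductOperators

variable {σ α : Type*} [Fintype σ]

/-- The two-copy operator on the sites `σ` which is the product of the local two-copy operators
`τ i`. -/
def prodTensor (τ : σ → TwoCopyOp α) : TwoCopyOp (σ → α) :=
  Matrix.of fun a b => ∏ i, τ i (a.1 i, a.2 i) (b.1 i, b.2 i)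

theorem prodTensor_smul_sum {κ : Type*} [Fintype κ] [DecidableEq σ] (c : ℂ)
    (X : κ → TwoCopyOp α) :
    prodTensor (fun _ : σ => c • ∑ s, X s) =
      c ^ Fintype.card σ • ∑ γ : σ → κ, prodTensor fun i => X (γ i) := by
  ext a b
  simp [prodTensor, Finset.prod_mul_distrib, Matrix.sum_apply, Finset.prod_univ_sum]

theorem prodTensor_single [DecidableEq α] (a : α) :
    prodTensor (fun _ : σ => Matrix.single (a, a) (a, a) (1 : ℂ)) =
      Matrix.single (fun _ => a, fun _ => a) (fun _ => a, fun _ => a) 1 := by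
  ext ⟨b, c⟩ ⟨d, e⟩
  simp [prodTensor, Matrix.single_apply, Finset.prod_ite_zero, funext_iff, forall_and]

theorem prodTensor_kronecker (A B : σ → Matrix α α ℂ) :
    prodTensor (fun i => A i ⊗ₖ B i) =
      (Matrix.of fun a b => ∏ i, A i (a i) (b i)) ⊗ₖ Matrix.of fun a b => ∏ i, B i (a i) (b i) := by
  ext a b
  simp [prodTensor, Finset.prod_mul_distrib]

variable [DecidableEq σ] [Fintype α]

theorem trace_prodTensor (τ : σ → TwoCopyOp α) : (prodTensor τ).trace = ∏ i, (τ i).trace := by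
  simp only [Matrix.trace, Finset.prod_univ_sum, Fintype.piFinset_univ]
  exact ((Equiv.arrowProdEquivProdArrow σ (fun _ => α) (fun _ => α)).sum_comp _).symm

theorem prodTensor_mul (ρ τ : σ → TwoCopyOp α) :
    prodTensor (fun i => ρ i * τ i) = prodTensor ρ * prodTensor τ := by
  ext a b
  simp only [prodTensor, Matrix.of_apply, Matrix.mul_apply, Finset.prod_univ_sum,
    Fintype.piFinset_univ, ← Finset.prod_mul_distrib]
  exact (Equiv.arrowProdEquivProdArrow σ (fun _ => α) (fun _ => α)).sum_comp
    fun c : (σ → α) × (σ → α) =>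
      ∏ i, ρ i (a.1 i, a.2 i) (c.1 i, c.2 i) * τ i (c.1 i, c.2 i) (b.1 i, b.2 i)

end ProductOperators

section PairOfSites

variable {σ α : Type*} [DecidableEq σ] {i j : σ}

/-- Configurations of `σ` split into their values at the two sites `i`, `j` and at the rest. -/
@[simps]
def splitPair (hij : i ≠ j) : (σ → α) ≃ (α × α) × ({k // k ≠ i ∧ k ≠ j} → α) where
  toFun a := ((a i, a j), fun k => a k)
  invFun p k := if hi : k = i then p.1.1 else if hj : k = j then p.1.2 else p.2 ⟨k, hi, hj⟩
  left_inv a := by ext k; dsimp only; split_ifs <;> simp_all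
  right_inv p := by
    ext k
    · simp
    · simp [hij.symm]
    · simp [k.2.1, k.2.2]

theorem prod_eq_mul_mul_prod_subtype {M : Type*} [CommMonoid M] [Fintype σ] (hij : i ≠ j)
    (f : σ → M) : ∏ k, f k = f i * f j * ∏ k : {k // k ≠ i ∧ k ≠ j}, f k := by
  rw [← Finset.mul_prod_erase Finset.univ f (Finset.mem_univ i),
    ← Finset.mul_prod_erase (Finset.univ.erase i) f
      (Finset.mem_erase.mpr ⟨hij.symm, Finset.mem_univ j⟩), mul_assoc,
    Finset.prod_subtype (p := fun k => k ≠ i ∧ k ≠ j) _ fun k => by simp [and_comm]]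

theorem embed_eq_submatrix {n q : ℕ} {i j : Fin n} (hij : i ≠ j) (W : TwoQuditOp q) :
    embed i j W = (W ⊗ₖ 1).submatrix (splitPair hij) (splitPair hij) := by
  ext a b
  simp [embed, Matrix.one_apply, funext_iff]

/-- The two-copy operator acting as `Y` on the pair of sites `(i, j)` and as the product of the
local operators `τ k` on the other sites. -/
def insertPair [Fintype σ] (hij : i ≠ j) (τ : σ → TwoCopyOp α) :
    TwoCopyOp (α × α) →ₗ[ℂ] TwoCopyOp (σ → α) :=
  (Matrix.reindexLinearEquiv ℂ ℂ ((splitPair hij).prodCongr (splitPair hij)).symm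
      ((splitPair hij).prodCongr (splitPair hij)).symm).toLinearMap ∘ₗ
    twoCopyTensor.flip (prodTensor fun k : {k // k ≠ i ∧ k ≠ j} => τ k)

theorem insertPair_twoCopyTensor [Fintype σ] (hij : i ≠ j) (τ : σ → TwoCopyOp α)
    (Y Z : TwoCopyOp α) : insertPair hij τ (twoCopyTensor Y Z) =
      prodTensor (Function.update (Function.update τ i Y) j Z) := by
  have hrest (k : {k // k ≠ i ∧ k ≠ j}) :
      Function.update (Function.update τ i Y) j Z k = τ k := by
    rw [Function.update_of_ne k.2.2, Function.update_of_ne k.2.1]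
  ext a b
  rw [prodTensor, Matrix.of_apply, prod_eq_mul_mul_prod_subtype hij]
  simp only [Function.update_self, Function.update_of_ne hij, hrest]
  rfl

theorem twoCopyConj_embed_insertPair {n q : ℕ} {i j : Fin n} (hij : i ≠ j) (W : TwoQuditOp q)
    (τ : Fin n → TwoCopyOp (Fin q)) (Y : TwoCopyOp (Fin q × Fin q)) :
    twoCopyConj (embed i j W) (insertPair hij τ Y) = insertPair hij τ (twoCopyConj W Y) := by
  rw [embed_eq_submatrix hij]
  refine (twoCopyConj_submatrix _ _ _).trans ?_
  refine (congrArg (Matrix.submatrix · _ _) (twoCopyConj_kronecker_twoCopyTensor W 1 Y _)).trans ?_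
  rw [map_one]
  rfl

/-- Assign the value `s` to both sites of the pair `e`. -/
def setBoth {β : Type*} (τ : σ → β) (e : σ × σ) (s : β) : σ → β :=
  Function.update (Function.update τ e.1 s) e.2 s

section SetBoth

variable {β : Type*} (τ : σ → β) {e : σ × σ} (s : β)

theorem setBoth_apply_fst : setBoth τ e s e.1 = s := by
  by_cases h : e.1 = e.2 <;> simp [setBoth, h]

theorem setBoth_apply_snd : setBoth τ e s e.2 = s := Function.update_self ..

theorem setBoth_apply_of_ne {k : σ} (hfst : k ≠ e.1) (hsnd : k ≠ e.2) :
    setBoth τ e s k = τ k := by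
  rw [setBoth, Function.update_of_ne hsnd, Function.update_of_ne hfst]

theorem setBoth_eq_self (h : τ e.1 = τ e.2) : setBoth τ e (τ e.1) = τ := by
  rw [setBoth, Function.update_eq_self, h, Function.update_eq_self]

theorem setBoth_comp {δ : Type*} (φ : β → δ) (e : σ × σ) :
    setBoth (φ ∘ τ) e (φ s) = φ ∘ setBoth τ e s := by
  simp only [setBoth, Function.comp_update]

end SetBoth

section

open scoped Matrix.Norms.L2Operator

theorem continuous_embed {n q : ℕ} (i j : Fin n) :
    Continuous (embed i j : TwoQuditOp q → QuditOp n q) := by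
  refine continuous_matrix fun a b => ?_
  simp only [embed, Matrix.of_apply]
  split_ifs <;> fun_prop

theorem IsTwoDesign.integral_twoCopyConj_embed_prodTensor {n q : ℕ} [Nontrivial (Fin q)]
    {μ : Measure (U2 q)} (hμ : IsTwoDesign μ) {A B : TwoQuditOp q}
    (hA : A ∈ Matrix.unitaryGroup (Fin q × Fin q) ℂ)
    (hB : B ∈ Matrix.unitaryGroup (Fin q × Fin q) ℂ) {i j : Fin n} (hij : i ≠ j)
    (τ : Fin n → TwoCopyOp (Fin q)) :
    (∫ V : U2 q, twoCopyConj (embed i j (A * V.1 * B)) ∂μ) (prodTensor τ) =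
      ∑ s, weingarten (q * q) (contract s (τ i) * contract s (τ j))
        (contract (!s) (τ i) * contract (!s) (τ j)) •
          prodTensor (setBoth τ (i, j) (copyPerm s)) := by
  have := hμ.isProbabilityMeasure
  have hAB : Continuous fun V : U2 q => A * V.1 * B := by fun_prop
  have hτ : prodTensor τ = insertPair hij τ (twoCopyTensor (τ i) (τ j)) := by
    rw [insertPair_twoCopyTensor, Function.update_eq_self, Function.update_eq_self]
  have hembed : Continuous fun V : U2 q => embed i j (A * V.1 * B) :=
    (continuous_embed i j).comp hAB
  rw [ContinuousLinearMap.integral_apply (integrable_twoCopyConj hembed), hτ]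
  simp only [twoCopyConj_embed_insertPair]
  refine ((insertPair hij τ).toContinuousLinearMap.integral_comp_comm
    ((integrable_twoCopyConj hAB).apply_continuousLinearMap _)).trans ?_
  rw [← ContinuousLinearMap.integral_apply (integrable_twoCopyConj hAB),
    hμ.integral_twoCopyConj_apply hA hB]
  simp [twirl, contract_twoCopyTensor, ← twoCopyTensor_copyPerm, insertPair_twoCopyTensor, setBoth]

end

end PairOfSites

/-! ### Domain-wall dynamics -/

section DomainWall

variable {σ : Type*} [DecidableEq σ]

/-- One step of the domain-wall recursion. A gate on the pair `e` fixes the identity/swap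
configurations (`false`/`true`) which agree on `e`, and replaces the others by the two
configurations with a common value on `e`, each with weight `κ`. -/
def wallStep (κ : ℝ) (e : σ × σ) : Module.End ℝ ((σ → Bool) → ℝ) where
  toFun f γ := if γ e.1 = γ e.2 then f γ else κ * ∑ s, f (setBoth γ e s)
  map_add' f g := by
    ext γ
    by_cases h : γ e.1 = γ e.2 <;> simp [h]
    ring
  map_smul' c f := by
    ext γ
    by_cases h : γ e.1 = γ e.2 <;> simp [h]
    ring

theorem wallStep_apply_of_eq {κ : ℝ} {e : σ × σ} {γ : σ → Bool} (h : γ e.1 = γ e.2)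
    (f : (σ → Bool) → ℝ) : wallStep κ e f γ = f γ := if_pos h

theorem wallStep_apply_of_ne {κ : ℝ} {e : σ × σ} {γ : σ → Bool} (h : γ e.1 ≠ γ e.2)
    (f : (σ → Bool) → ℝ) : wallStep κ e f γ = κ * ∑ s, f (setBoth γ e s) := if_neg h

/-- The domain-wall recursion along a list of gates, the head of the list acting first on the
configurations. -/
def transfer (κ : ℝ) (G : List (σ × σ)) : Module.End ℝ ((σ → Bool) → ℝ) :=
  (G.map (wallStep κ)).prod

theorem transfer_cons (κ : ℝ) (e : σ × σ) (G : List (σ × σ)) (f : (σ → Bool) → ℝ) :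
    transfer κ (e :: G) f = wallStep κ e (transfer κ G f) := by
  simp [transfer]

theorem transfer_append (κ : ℝ) (G G' : List (σ × σ)) (f : (σ → Bool) → ℝ) :
    transfer κ (G ++ G') f = transfer κ G (transfer κ G' f) := by
  simp [transfer]

theorem transfer_mono {κ : ℝ} (hκ : 0 ≤ κ) (G : List (σ × σ)) : Monotone (transfer κ G) := by
  intro f f' hf
  induction G with
  | nil => exact hf
  | cons e G ih =>
    intro γ
    rw [transfer_cons, transfer_cons]
    by_cases h : γ e.1 = γ e.2
    · simpa only [wallStep_apply_of_eq h] using ih γ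
    · simp only [wallStep_apply_of_ne h]
      gcongr
      exact ih _

theorem transfer_apply_of_const (κ : ℝ) (G : List (σ × σ)) (f : (σ → Bool) → ℝ) {γ : σ → Bool}
    (hγ : ∀ i j, γ i = γ j) : transfer κ G f γ = f γ := by
  induction G with
  | nil => rfl
  | cons e G ih => rw [transfer_cons, wallStep_apply_of_eq (hγ _ _), ih]

theorem wallStep_comp_compl (κ : ℝ) (e : σ × σ) (f : (σ → Bool) → ℝ) :
    wallStep κ e (f ∘ compl) = wallStep κ e f ∘ compl := by
  have hset (γ : σ → Bool) (s : Bool) : (setBoth γ e s)ᶜ = setBoth γᶜ e (!s) := by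
    ext i
    simp only [setBoth, Pi.compl_apply, Function.update_apply]
    split_ifs <;> rfl
  ext γ
  by_cases h : γ e.1 = γ e.2
  · have h' : γᶜ e.1 = γᶜ e.2 := by simp [h]
    simp [wallStep_apply_of_eq h, wallStep_apply_of_eq h']
  · have h' : γᶜ e.1 ≠ γᶜ e.2 := by simpa using h
    simp [wallStep_apply_of_ne h, wallStep_apply_of_ne h', hset, add_comm]

theorem transfer_comp_compl (κ : ℝ) (G : List (σ × σ)) (f : (σ → Bool) → ℝ) :
    transfer κ G (f ∘ compl) = transfer κ G f ∘ compl := by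
  induction G with
  | nil => rfl
  | cons e G ih => rw [transfer_cons, ih, wallStep_comp_compl, transfer_cons]

section Decay

variable {κ c : ℝ} {f : (σ → Bool) → ℝ}

theorem wallStep_apply_le_of_ne (hκ : 0 ≤ κ) (hf : ∀ γ, f γ ≤ c) {e : σ × σ} {γ : σ → Bool}
    (h : γ e.1 ≠ γ e.2) : wallStep κ e f γ ≤ 2 * κ * c := by
  rw [wallStep_apply_of_ne h, Fintype.sum_bool, mul_comm 2, mul_assoc, two_mul]
  gcongr <;> exact hf _

theorem transfer_apply_le (hκ : 0 ≤ κ) (hκ' : 2 * κ ≤ 1) (hc : 0 ≤ c) (hf : ∀ γ, f γ ≤ c)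
    (G : List (σ × σ)) (γ : σ → Bool) : transfer κ G f γ ≤ c := by
  induction G generalizing γ with
  | nil => exact hf γ
  | cons e G ih =>
    rw [transfer_cons]
    by_cases h : γ e.1 = γ e.2
    · exact (wallStep_apply_of_eq h _).trans_le (ih γ)
    · exact (wallStep_apply_le_of_ne hκ ih h).trans (mul_le_of_le_one_left hc hκ')

theorem transfer_apply_le_of_exists_ne (hκ : 0 ≤ κ) (hκ' : 2 * κ ≤ 1) (hc : 0 ≤ c)
    (hf : ∀ γ, f γ ≤ c) {G : List (σ × σ)} {γ : σ → Bool} (hG : ∃ e ∈ G, γ e.1 ≠ γ e.2) :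
    transfer κ G f γ ≤ 2 * κ * c := by
  induction G with
  | nil => simp at hG
  | cons e G ih =>
    rw [transfer_cons]
    by_cases h : γ e.1 = γ e.2
    · rw [wallStep_apply_of_eq h]
      exact ih (by simpa [h] using hG)
    · exact wallStep_apply_le_of_ne hκ (transfer_apply_le hκ hκ' hc hf G) h

variable (σ) in
/-- The configurations which have a domain wall. -/
def nonconst : Set (σ → Bool) := {γ | ∃ i j, γ i ≠ γ j}

theorem transfer_flatten_append_indicator_nonconst_le (hκ : 0 ≤ κ) (hκ' : 2 * κ ≤ 1)
    {Gs : List (List (σ × σ))} (hGs : ∀ G ∈ Gs, ∀ γ ∈ nonconst σ, ∃ e ∈ G, γ e.1 ≠ γ e.2)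
    (G : List (σ × σ)) (γ : σ → Bool) :
    transfer κ (Gs.flatten ++ G) ((nonconst σ).indicator 1) γ ≤ (2 * κ) ^ Gs.length := by
  have h2κ : 0 ≤ 2 * κ := by positivity
  induction Gs generalizing γ with
  | nil =>
    exact transfer_apply_le hκ hκ' zero_le_one
      (Set.indicator_le_self' (f := 1) fun _ _ => zero_le_one) G γ
  | cons G' Gs ih =>
    rw [List.length_cons, pow_succ']
    by_cases hγ : γ ∈ nonconst σ
    · rw [List.flatten_cons, List.append_assoc, transfer_append]
      exact transfer_apply_le_of_exists_ne hκ hκ' (pow_nonneg h2κ _)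
        (ih fun G hG => hGs G (List.mem_cons_of_mem _ hG)) (hGs G' List.mem_cons_self γ hγ)
    · rw [transfer_apply_of_const κ _ _ (by simpa [nonconst] using hγ),
        Set.indicator_of_notMem hγ]
      positivity

end Decay

section Sorted

variable {β : Type*} {ℓ : β → ℕ} {ks : List β}

theorem filter_eq_append_filter_lt (hks : ks.Pairwise fun a b => ℓ a ≤ ℓ b) (w : ℕ) :
    ks.filter (ℓ · = w) ++ ks.filter (w < ℓ ·) = ks.filter (w ≤ ℓ ·) := by
  induction ks with
  | nil => rfl
  | cons a ks ih =>
    rw [List.pairwise_cons] at hks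
    rcases lt_trichotomy (ℓ a) w with h | rfl | h
    · simpa [h.ne, h.not_ge, h.not_gt] using ih hks.2
    · simpa using ih hks.2
    · have hlt : ∀ b ∈ ks, w < ℓ b := fun b hb => h.trans_le (hks.1 b hb)
      have heq : ks.filter (ℓ · = w) = [] :=
        List.filter_eq_nil_iff.mpr fun b hb => by simpa using (hlt b hb).ne'
      simpa [h, h.ne', h.le, heq] using ih hks.2

theorem flatten_map_filter_append_filter (hks : ks.Pairwise fun a b => ℓ a ≤ ℓ b) (w : ℕ) :
    ((List.range w).map fun j => ks.filter (ℓ · = j)).flatten ++ ks.filter (w ≤ ℓ ·) = ks := by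
  induction w with
  | zero => simp
  | succ w ih =>
    rw [List.range_succ, List.map_append, List.flatten_append, List.append_assoc,
      List.map_singleton, List.flatten_singleton]
    exact (congrArg _ (filter_eq_append_filter_lt hks w)).trans ih

end Sorted

section TotalWeight

variable [Fintype σ] {q : ℝ}

/-- The trace, for local dimension `q`, of the permutation operator of an identity/swap
configuration. -/
def permTrace (q : ℝ) (γ : σ → Bool) : ℝ := ∏ i, if γ i then q else q ^ 2

theorem wallStep_permTrace {e : σ × σ} (he : e.1 ≠ e.2) :
    wallStep (q / (q ^ 2 + 1)) e (permTrace q) = permTrace q := by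
  ext γ
  by_cases h : γ e.1 = γ e.2
  · exact wallStep_apply_of_eq h _
  have hpair : (if γ e.1 then q else q ^ 2) * (if γ e.2 then q else q ^ 2) = q * q ^ 2 := by
    cases h1 : γ e.1 <;> cases h2 : γ e.2 <;> simp_all [mul_comm]
  have hset (s : Bool) : permTrace q (setBoth γ e s) = (if s then q else q ^ 2) ^ 2 *
      ∏ k : {k // k ≠ e.1 ∧ k ≠ e.2}, if γ k then q else q ^ 2 := by
    have hrest (k : {k // k ≠ e.1 ∧ k ≠ e.2}) : setBoth γ e s k = γ k :=
      setBoth_apply_of_ne γ s k.2.1 k.2.2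
    simp only [permTrace, prod_eq_mul_mul_prod_subtype he, hrest, setBoth_apply_fst,
      setBoth_apply_snd, ← sq]
  rw [wallStep_apply_of_ne h, Fintype.sum_bool, hset, hset, permTrace,
    prod_eq_mul_mul_prod_subtype he, hpair]
  have hq : q ^ 2 + 1 ≠ 0 := by positivity
  simp only [Bool.false_eq_true, if_false, if_true]
  field_simp
  ring

theorem transfer_permTrace {G : List (σ × σ)} (hG : ∀ e ∈ G, e.1 ≠ e.2) :
    transfer (q / (q ^ 2 + 1)) G (permTrace q) = permTrace q := by
  induction G with
  | nil => rfl
  | cons e G ih =>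
    rw [List.forall_mem_cons] at hG
    rw [transfer_cons, ih hG.2, wallStep_permTrace hG.1]

theorem sum_permTrace : ∑ γ : σ → Bool, permTrace q γ = (q * (q + 1)) ^ Fintype.card σ := by
  refine (Fintype.prod_sum fun (_ : σ) (s : Bool) => if s then q else q ^ 2).symm.trans ?_
  simp only [Fintype.sum_bool, if_true, Bool.false_eq_true, if_false, Finset.prod_const,
    Finset.card_univ]
  ring

theorem sum_transfer_single_bot (κ : ℝ) (G : List (σ × σ)) :
    ∑ γ, transfer κ G (Pi.single ⊥ 1) γ = ∑ γ, transfer κ G (Pi.single ⊤ 1) γ := by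
  have hcompl : (Pi.single ⊥ 1 : (σ → Bool) → ℝ) = Pi.single ⊤ 1 ∘ compl := by
    ext γ
    simp [Pi.single_apply]
  rw [hcompl, transfer_comp_compl]
  exact Equiv.sum_comp (Function.Involutive.toPerm compl compl_involutive) (transfer κ G _)

omit [DecidableEq σ] in
theorem single_bot_add_single_top_le_permTrace [Nonempty σ] (hq : 0 ≤ q) :
    q ^ (2 * Fintype.card σ) • Pi.single ⊥ 1 + q ^ Fintype.card σ • Pi.single ⊤ 1 ≤
      permTrace (σ := σ) q := by
  intro γ
  have hnonneg : 0 ≤ permTrace q γ := Finset.prod_nonneg fun i _ => by split_ifs <;> positivity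
  by_cases h0 : γ = ⊥
  · simp [h0, permTrace, pow_mul]
  · by_cases h1 : γ = ⊤
    · simp [h1, permTrace]
    · simpa [h0, h1] using hnonneg

/-- The weight of the all-swap configuration is bounded by conservation of the trace, using that
by symmetry the all-identity configuration has the same weight. -/
theorem sum_transfer_single_top_le [Nonempty σ] (hq : 0 ≤ q) {G : List (σ × σ)}
    (hG : ∀ e ∈ G, e.1 ≠ e.2) :
    (q ^ (2 * Fintype.card σ) + q ^ Fintype.card σ) *
        ∑ γ, transfer (q / (q ^ 2 + 1)) G (Pi.single ⊤ 1) γ ≤ (q * (q + 1)) ^ Fintype.card σ := by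
  have hle := transfer_mono (by positivity : 0 ≤ q / (q ^ 2 + 1)) G
    (single_bot_add_single_top_le_permTrace (σ := σ) hq)
  rw [transfer_permTrace hG] at hle
  calc _ = ∑ γ, transfer (q / (q ^ 2 + 1)) G (q ^ (2 * Fintype.card σ) • Pi.single ⊥ 1 +
        q ^ Fintype.card σ • Pi.single ⊤ 1) γ := by
        simp only [map_add, map_smul, Pi.add_apply, Pi.smul_apply, smul_eq_mul,
          Finset.sum_add_distrib, ← Finset.mul_sum, sum_transfer_single_bot, add_mul]
    _ ≤ ∑ γ, permTrace q γ := Finset.sum_le_sum fun γ _ => hle γ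
    _ = _ := sum_permTrace

end TotalWeight

section Observable

variable [Fintype σ] {q : ℝ}

/-- The weight of an identity/swap configuration against a product of local observables of
normalized Hilbert-Schmidt norm, of which those at the sites in `S` are traceless and the others
are the identity. -/
def observableWeight (q : ℝ) (S : Finset σ) (γ : σ → Bool) : ℝ :=
  ∏ i, if γ i then q else if i ∈ S then 0 else q ^ 2

theorem observableWeight_le_mul_inv (hq : 1 ≤ q) (S : Finset σ) (γ : σ → Bool) :
    observableWeight q S γ ≤ q ^ (2 * Fintype.card σ) * (q ^ S.card)⁻¹ := by
  have hq0 : 0 < q := by linarith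
  have hself : q ^ 2 * q⁻¹ = q := by field_simp
  calc observableWeight q S γ ≤ ∏ i, q ^ 2 * (if i ∈ S then q⁻¹ else 1) := by
        refine Finset.prod_le_prod (fun i _ => by split_ifs <;> positivity) fun i _ => ?_
        split_ifs
        · exact hself.ge
        · nlinarith
        · exact hself.symm ▸ hq0.le
        · simp
    _ = q ^ (2 * Fintype.card σ) * (q ^ S.card)⁻¹ := by
        rw [Finset.prod_mul_distrib, Finset.prod_ite_mem]
        simp [pow_mul]

theorem observableWeight_le (hq : 1 ≤ q) {S : Finset σ} (hS : S.Nonempty) :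
    observableWeight q S ≤
      (q ^ (2 * Fintype.card σ) * (q ^ S.card)⁻¹) • (nonconst σ).indicator 1 +
        q ^ Fintype.card σ • Pi.single ⊤ 1 := by
  have : 0 < q := by linarith
  intro γ
  have hsingle : 0 ≤ (Pi.single ⊤ 1 : (σ → Bool) → ℝ) γ := by
    rw [Pi.single_apply]
    split_ifs <;> norm_num
  by_cases hγ : γ ∈ nonconst σ
  · simpa [hγ] using (observableWeight_le_mul_inv hq S γ).trans
      (le_add_of_nonneg_right (mul_nonneg (by positivity) hsingle))
  obtain ⟨i, hi⟩ := hS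
  have hconst (k : σ) : γ k = γ i := by
    by_contra h
    exact hγ ⟨k, i, h⟩
  cases h : γ i
  · have hzero : observableWeight q S γ = 0 :=
      Finset.prod_eq_zero (Finset.mem_univ i) (by simp [h, hi])
    simpa [hγ, hzero] using mul_nonneg (by positivity) hsingle
  · have htop : γ = ⊤ := funext fun k => (hconst k).trans h
    simp [htop ▸ hγ, htop, observableWeight]

theorem sum_transfer_observableWeight_le {B : ℝ} (hq : 1 ≤ q) {G : List (σ × σ)}
    (hG : ∀ e ∈ G, e.1 ≠ e.2)
    (hB : ∀ γ, transfer (q / (q ^ 2 + 1)) G ((nonconst σ).indicator 1) γ ≤ B) {S : Finset σ}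
    (hS : S.Nonempty) :
    ((q * (q + 1)) ^ Fintype.card σ)⁻¹ *
        ∑ γ, transfer (q / (q ^ 2 + 1)) G (observableWeight q S) γ ≤
      (2 * q / (q + 1)) ^ Fintype.card σ * B * (q ^ S.card)⁻¹ + (q ^ Fintype.card σ + 1)⁻¹ := by
  have hq0 : 0 < q := by linarith
  have hle := transfer_mono (by positivity : 0 ≤ q / (q ^ 2 + 1)) G (observableWeight_le hq hS)
  have : Nonempty σ := hS.to_subtype.map Subtype.val
  have hswap := sum_transfer_single_top_le hq0.le hG
  have hwall : ∑ γ, transfer (q / (q ^ 2 + 1)) G ((nonconst σ).indicator 1) γ ≤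
      2 ^ Fintype.card σ * B :=
    (Finset.sum_le_sum fun γ _ => hB γ).trans_eq (by simp)
  set N := Fintype.card σ
  set Z := ∑ γ, transfer (q / (q ^ 2 + 1)) G (Pi.single ⊤ 1) γ
  have hZ : ((q * (q + 1)) ^ N)⁻¹ * (q ^ N * Z) ≤ (q ^ N + 1)⁻¹ := by
    rw [inv_mul_le_iff₀ (by positivity), le_mul_inv_iff₀ (by positivity)]
    calc _ = (q ^ (2 * N) + q ^ N) * Z := by ring
      _ ≤ _ := hswap
  have hpow : ((q * (q + 1)) ^ N)⁻¹ * (q ^ (2 * N) * 2 ^ N) = (2 * q / (q + 1)) ^ N := by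
    rw [pow_mul, ← mul_pow, ← inv_pow, ← mul_pow]
    congr 1
    field_simp
  calc _ ≤ ((q * (q + 1)) ^ N)⁻¹ * ∑ γ, transfer (q / (q ^ 2 + 1)) G
        ((q ^ (2 * N) * (q ^ S.card)⁻¹) • (nonconst σ).indicator 1 +
          q ^ N • Pi.single ⊤ 1) γ := by
        gcongr with γ
        exact hle γ
    _ = ((q * (q + 1)) ^ N)⁻¹ * (q ^ (2 * N) * (q ^ S.card)⁻¹ *
          ∑ γ, transfer (q / (q ^ 2 + 1)) G ((nonconst σ).indicator 1) γ) +
        ((q * (q + 1)) ^ N)⁻¹ * (q ^ N * Z) := by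
        simp only [map_add, map_smul, Pi.add_apply, Pi.smul_apply, smul_eq_mul,
          Finset.sum_add_distrib, ← Finset.mul_sum, mul_add, Z]
    _ ≤ ((q * (q + 1)) ^ N)⁻¹ * (q ^ (2 * N) * (q ^ S.card)⁻¹ * (2 ^ N * B)) +
        (q ^ N + 1)⁻¹ := by gcongr
    _ = _ := by rw [← hpow]; ring

end Observable

end DomainWall

/-! ### Sequences of twirls -/

section GateSequence

variable {β σ α : Type*} [Fintype σ] [DecidableEq σ] [Fintype α] [DecidableEq α]

/-- The `k`-th operation acts on product two-copy operators as the Haar twirl of the pair of sites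
`g k`. -/
def ActsAsTwirl (g : β → σ × σ)
    (E : β → TwoCopyOp (σ → α) →L[ℂ] TwoCopyOp (σ → α)) : Prop :=
  ∀ k τ, E k (prodTensor τ) =
    ∑ s, weingarten (Fintype.card α * Fintype.card α)
      (contract s (τ (g k).1) * contract s (τ (g k).2))
      (contract (!s) (τ (g k).1) * contract (!s) (τ (g k).2)) •
        prodTensor (setBoth τ (g k) (copyPerm s))

variable {g : β → σ × σ} {E : β → TwoCopyOp (σ → α) →L[ℂ] TwoCopyOp (σ → α)}

omit [Fintype σ] [Fintype α] [DecidableEq σ] [DecidableEq α] in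
theorem reverse_prod_cons_apply (k : β) (ks : List β) (X : TwoCopyOp (σ → α)) :
    ((k :: ks).map E).reverse.prod X = (ks.map E).reverse.prod (E k X) := by
  simp

theorem ActsAsTwirl.reverse_prod_apply_congr (hE : ActsAsTwirl g E) (ks : List β)
    {τ τ' : σ → TwoCopyOp α} (hcontract : ∀ s i, contract s (τ i) = contract s (τ' i))
    (heq : ∀ i, (∀ k ∈ ks, i ≠ (g k).1 ∧ i ≠ (g k).2) → τ i = τ' i) :
    (ks.map E).reverse.prod (prodTensor τ) = (ks.map E).reverse.prod (prodTensor τ') := by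
  induction ks generalizing τ τ' with
  | nil => rw [funext fun i => heq i (by simp)]
  | cons k ks ih =>
    simp only [reverse_prod_cons_apply, hE k, hcontract, map_sum, map_smul]
    refine Finset.sum_congr rfl fun s _ => congrArg _ (ih (fun t i => ?_) fun i hi => ?_)
    all_goals
      by_cases hfst : i = (g k).1
      · simp only [hfst, setBoth_apply_fst]
      by_cases hsnd : i = (g k).2
      · simp only [hsnd, setBoth_apply_snd]
      rw [setBoth_apply_of_ne _ _ hfst hsnd, setBoth_apply_of_ne _ _ hfst hsnd]
    · exact hcontract t i
    · exact heq i (List.forall_mem_cons.mpr ⟨⟨hfst, hsnd⟩, hi⟩)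

theorem weingarten_contract_copyPerm [Nontrivial α] (s t t' : Bool) :
    weingarten (Fintype.card α * Fintype.card α)
      (contract s (copyPerm t : TwoCopyOp α) * contract s (copyPerm t' : TwoCopyOp α))
      (contract (!s) (copyPerm t : TwoCopyOp α) * contract (!s) (copyPerm t' : TwoCopyOp α)) =
      if t = t' then if s = t then 1 else 0
      else (Fintype.card α : ℂ) / ((Fintype.card α : ℂ) ^ 2 + 1) := by
  have hq : (Fintype.card α : ℂ) ≠ 0 := Nat.cast_ne_zero.mpr Fintype.card_ne_zero
  have hsub : (Fintype.card α : ℂ) ^ 2 - 1 ≠ 0 := by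
    rw [sub_ne_zero]
    exact_mod_cast (Nat.one_lt_pow two_ne_zero Fintype.one_lt_card).ne'
  have hadd : (Fintype.card α : ℂ) ^ 2 + 1 ≠ 0 := by norm_cast
  have hfactor : ((Fintype.card α : ℂ) * Fintype.card α) ^ 2 - 1 =
      ((Fintype.card α : ℂ) ^ 2 - 1) * ((Fintype.card α : ℂ) ^ 2 + 1) := by ring
  simp only [contract_copyPerm, weingarten, hfactor]
  cases s <;> cases t <;> cases t' <;> simp <;> grind

theorem ActsAsTwirl.apply_prodTensor_copyPerm_of_eq [Nontrivial α] (hE : ActsAsTwirl g E) {k : β}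
    {γ : σ → Bool} (h : γ (g k).1 = γ (g k).2) :
    E k (prodTensor (copyPerm ∘ γ)) = prodTensor (copyPerm ∘ γ) := by
  simp only [hE k, Function.comp_apply, weingarten_contract_copyPerm, ← h, if_true, ite_smul,
    one_smul, zero_smul, Finset.sum_ite_eq', Finset.mem_univ]
  rw [setBoth_comp, setBoth_eq_self γ h]

theorem ActsAsTwirl.apply_prodTensor_copyPerm_of_ne [Nontrivial α] (hE : ActsAsTwirl g E) {k : β}
    {γ : σ → Bool} (h : γ (g k).1 ≠ γ (g k).2) :
    E k (prodTensor (copyPerm ∘ γ)) =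
      ((Fintype.card α : ℂ) / ((Fintype.card α : ℂ) ^ 2 + 1)) •
        ∑ s, prodTensor (copyPerm ∘ setBoth γ (g k) s) := by
  simp only [hE k, Function.comp_apply, weingarten_contract_copyPerm, h, if_false, setBoth_comp,
    Finset.smul_sum]

theorem ActsAsTwirl.map_reverse_prod_apply [Nontrivial α] (hE : ActsAsTwirl g E) (ks : List β)
    (φ : TwoCopyOp (σ → α) →ₗ[ℂ] ℂ) {f : (σ → Bool) → ℝ}
    (hφ : ∀ γ : σ → Bool, φ (prodTensor (copyPerm ∘ γ)) = f γ) (γ : σ → Bool) :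
    φ ((ks.map E).reverse.prod (prodTensor (copyPerm ∘ γ))) =
      transfer (Fintype.card α / ((Fintype.card α : ℝ) ^ 2 + 1)) (ks.map g) f γ := by
  induction ks generalizing γ with
  | nil => exact hφ γ
  | cons k ks ih =>
    rw [reverse_prod_cons_apply, List.map_cons, transfer_cons]
    by_cases h : γ (g k).1 = γ (g k).2
    · rw [hE.apply_prodTensor_copyPerm_of_eq h, wallStep_apply_of_eq h, ih]
    · rw [hE.apply_prodTensor_copyPerm_of_ne h, wallStep_apply_of_ne h]
      simp [ih, mul_add]

end GateSequence

/-! ### Parameterized gates, observables and architectures -/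

section ParamGates

variable {q p : ℕ}

theorem exp_smul_mem_unitaryGroup {ι : Type*} [Fintype ι] [DecidableEq ι] {A : Matrix ι ι ℂ}
    (hA : A.IsHermitian) (t : ℝ) :
    NormedSpace.exp ((-((t : ℂ) * Complex.I)) • A) ∈ Matrix.unitaryGroup ι ℂ := by
  set X := (-((t : ℂ) * Complex.I)) • A with hX
  have hskew : Xᴴ = -X := by
    simp [hX, Matrix.conjTranspose_smul, hA.eq]
  rw [Matrix.mem_unitaryGroup_iff, Matrix.star_eq_conjTranspose, ← Matrix.exp_conjTranspose, hskew,
    ← Matrix.exp_add_of_commute _ _ (Commute.refl X).neg_right, add_neg_cancel,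
    NormedSpace.exp_zero]

theorem ParamGate.toOp_mem_unitaryGroup (G : ParamGate q p) (θ : Fin p → ℝ) :
    G.toOp θ ∈ Matrix.unitaryGroup (Fin q × Fin q) ℂ :=
  mul_mem (mul_mem G.Wl.2 (exp_smul_mem_unitaryGroup G.isHermitian _)) G.Wr.2

theorem paramProd_mem_unitaryGroup (L : List (ParamGate q p)) (θ : Fin p → ℝ) :
    paramProd L θ ∈ Matrix.unitaryGroup (Fin q × Fin q) ℂ := by
  refine list_prod_mem fun W hW => ?_
  obtain ⟨G, -, rfl⟩ := List.mem_map.mp (List.mem_reverse.mp hW)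
  exact G.toOp_mem_unitaryGroup θ

open scoped Matrix.Norms.Operator in
theorem continuous_matrix_exp {ι : Type*} [Fintype ι] [DecidableEq ι] :
    Continuous (NormedSpace.exp : Matrix ι ι ℂ → Matrix ι ι ℂ) :=
  NormedSpace.exp_continuous

theorem ParamGate.continuous_toOp (G : ParamGate q p) : Continuous G.toOp := by
  have h : Continuous fun θ : Fin p → ℝ => (-((θ G.param : ℂ) * Complex.I)) • G.A := by
    fun_prop
  exact (continuous_const.matrix_mul (continuous_matrix_exp.comp h)).matrix_mul continuous_const

theorem continuous_paramProd (L : List (ParamGate q p)) : Continuous (paramProd L) := by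
  unfold paramProd
  simp only [← List.map_reverse]
  exact continuous_list_prod _ fun G _ => G.continuous_toOp

end ParamGates

section Observables

theorem norm_sq_conj_apply_eq_trace {ι : Type*} [Fintype ι] [DecidableEq ι] (U O : Matrix ι ι ℂ)
    (a : ι) :
    ((‖(Uᴴ * O * U) a a‖ ^ 2 : ℝ) : ℂ) =
      ((O ⊗ₖ Oᴴ) * twoCopyConj U (Matrix.single (a, a) (a, a) 1)).trace := by
  have htrace : ∀ N : Matrix ι ι ℂ,
      (N * (U * Matrix.single a a 1 * Uᴴ)).trace = (Uᴴ * N * U) a a := fun N => by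
    rw [← mul_assoc, Matrix.trace_mul_comm, ← mul_assoc, ← mul_assoc, Matrix.trace_mul_single,
      MulOpposite.op_one, one_smul]
  have hsingle : Matrix.single (a, a) (a, a) (1 : ℂ) =
      Matrix.single a a 1 ⊗ₖ Matrix.single a a 1 := by
    rw [Matrix.single_kronecker_single, one_mul]
  have hstar : (Uᴴ * Oᴴ * U) a a = starRingEnd ℂ ((Uᴴ * O * U) a a) := by
    rw [starRingEnd_apply, ← Matrix.conjTranspose_apply]
    simp only [Matrix.conjTranspose_mul, Matrix.conjTranspose_conjTranspose, mul_assoc]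
  rw [hsingle, twoCopyConj_apply, Matrix.conjTranspose_kronecker, ← Matrix.mul_kronecker_mul,
    ← Matrix.mul_kronecker_mul, ← Matrix.mul_kronecker_mul, Matrix.trace_kronecker, htrace, htrace,
    hstar, Complex.mul_conj', Complex.ofReal_pow]

theorem contract_single {ι : Type*} [Fintype ι] [DecidableEq ι] (s : Bool) (a : ι) :
    contract s (Matrix.single (a, a) (a, a) 1) = 1 := by
  rw [contract_apply, Matrix.trace_mul_single, MulOpposite.op_one, one_smul, copyPerm_apply]
  cases s <;> simp

theorem trace_prodTensor_mul_prodTensor_copyPerm {σ α : Type*} [Fintype σ] [DecidableEq σ]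
    [Fintype α] [DecidableEq α] (ρ : σ → TwoCopyOp α) (γ : σ → Bool) :
    (prodTensor ρ * prodTensor (copyPerm ∘ γ)).trace = ∏ i, contract (γ i) (ρ i) := by
  simp only [← prodTensor_mul, trace_prodTensor, contract_apply, Matrix.trace_mul_comm (ρ _),
    Function.comp_apply]

variable {n q : ℕ} [NeZero q] {M : Fin (q ^ 2) → Matrix (Fin q) (Fin q) ℂ}

omit [NeZero q] in
theorem tensorOp_kronecker_conjTranspose (x : Fin n → Fin (q ^ 2)) :
    tensorOp M x ⊗ₖ (tensorOp M x)ᴴ = prodTensor fun i => M (x i) ⊗ₖ (M (x i))ᴴ := by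
  rw [prodTensor_kronecker, tensorOp]
  congr 1
  ext a b
  simp

theorem IsOperatorBasis.contract_kronecker_conjTranspose (hM : IsOperatorBasis M) (s : Bool)
    (k : Fin (q ^ 2)) :
    contract s (M k ⊗ₖ (M k)ᴴ) = if s then (q : ℂ) else if k ≠ 0 then 0 else (q : ℂ) ^ 2 := by
  cases s
  · rw [contract_false_kronecker]
    by_cases hk : k = 0
    · simp [hk, hM.1, sq]
    · have htrace : (M k).trace = 0 := by simpa [hM.1, Ne.symm hk] using hM.2 0 k
      simp [hk, htrace]
  · rw [contract_true_kronecker, Matrix.trace_mul_comm, hM.2]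
    simp

theorem IsOperatorBasis.trace_tensorOp_mul_prodTensor_copyPerm (hM : IsOperatorBasis M)
    (x : Fin n → Fin (q ^ 2)) (γ : Fin n → Bool) :
    ((tensorOp M x ⊗ₖ (tensorOp M x)ᴴ) * prodTensor (copyPerm ∘ γ)).trace =
      (observableWeight (q : ℝ) (Finset.univ.filter fun i => x i ≠ 0) γ : ℂ) := by
  rw [tensorOp_kronecker_conjTranspose, trace_prodTensor_mul_prodTensor_copyPerm, observableWeight,
    Complex.ofReal_prod]
  refine Finset.prod_congr rfl fun i _ => ?_
  rw [hM.contract_kronecker_conjTranspose]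
  split_ifs <;> simp_all

end Observables

section Architecture

variable {n r : ℕ} {C : Architecture n}

/-- The pairs of sites acted on by the entangling gates, in time order. -/
def Architecture.pairs (C : Architecture n) : List (Fin n × Fin n) :=
  (List.finRange C.m).map fun k => (C.fst k, C.snd k)

theorem Architecture.IsRegularlyConnected.pos (hn : 0 < n) (hr : C.IsRegularlyConnected r) :
    0 < r := by
  rcases Nat.eq_zero_or_pos r with rfl | hpos
  · obtain ⟨k, -⟩ := C.covers ⟨0, hn⟩
    have hne : ({C.fst k} : Finset (Fin n)) ≠ Finset.univ := fun h =>
      C.fst_ne_snd k (Finset.mem_singleton.mp (h ▸ Finset.mem_univ (C.snd k))).symm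
    obtain ⟨l, hlo, hhi, -⟩ := hr 0 (Nat.zero_le _) _ (Finset.singleton_nonempty _) hne
    omega
  · exact hpos

theorem Architecture.IsRegularlyConnected.exists_ne (hr : C.IsRegularlyConnected r) {t : ℕ}
    (ht : t + r ≤ C.d) {γ : Fin n → Bool} (hγ : γ ∈ nonconst (Fin n)) :
    ∃ k, t ≤ (C.layer k : ℕ) ∧ (C.layer k : ℕ) < t + r ∧ γ (C.fst k) ≠ γ (C.snd k) := by
  obtain ⟨i, j, hij⟩ := hγ
  obtain ⟨k, hlo, hhi, hcross⟩ := hr t ht (Finset.univ.filter fun i => γ i = true)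
    (Finset.filter_nonempty_iff.mpr (by grind)) (fun h => hij (by
      rw [Finset.filter_eq_self.mp h i (Finset.mem_univ i),
        Finset.filter_eq_self.mp h j (Finset.mem_univ j)]))
  refine ⟨k, hlo, hhi, ?_⟩
  simp only [Architecture.Crosses, Finset.mem_filter, Finset.mem_univ, true_and] at hcross
  grind

theorem Architecture.IsRegularlyConnected.transfer_indicator_nonconst_le {κ : ℝ} (hκ : 0 ≤ κ)
    (hκ' : 2 * κ ≤ 1) (hr : C.IsRegularlyConnected r) (γ : Fin n → Bool) :
    transfer κ C.pairs ((nonconst (Fin n)).indicator 1) γ ≤ (2 * κ) ^ (C.d / r) := by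
  have hsorted : (List.finRange C.m).Pairwise fun a b => (C.layer a : ℕ) / r ≤ C.layer b / r :=
    (List.pairwise_le_finRange C.m).imp fun hab => Nat.div_le_div_right (C.layer_mono hab)
  rw [Architecture.pairs, ← flatten_map_filter_append_filter hsorted (C.d / r), List.map_append,
    List.map_flatten, List.map_map]
  refine (transfer_flatten_append_indicator_nonconst_le hκ hκ' (fun G hG γ hγ => ?_) _ γ).trans
    (by simp)
  obtain ⟨j, hj, rfl⟩ := List.mem_map.mp hG
  have hjr : j * r + r ≤ C.d := by
    calc j * r + r = (j + 1) * r := by ring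
      _ ≤ C.d / r * r := Nat.mul_le_mul_right r (List.mem_range.mp hj)
      _ ≤ C.d := Nat.div_mul_le_self _ _
  obtain ⟨k, hlo, hhi, hne⟩ := hr.exists_ne hjr hγ
  have hwindow : (C.layer k : ℕ) / r = j :=
    Nat.div_eq_of_lt_le hlo (by rwa [Nat.succ_mul])
  exact ⟨_, List.mem_map.mpr ⟨k, by simp [hwindow], rfl⟩, hne⟩

end Architecture

/-! ### Second moments of circuits -/

section Circuit

open scoped Matrix.Norms.L2Operator

variable {n q p : ℕ} (C : VarCircuit n q p) (μ : Fin C.m → Measure (U2 q))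

/-- The average of the two-copy action of the `k`-th block over its entangling gate. -/
def VarCircuit.meanBlock (θ : Fin p → ℝ) (k : Fin C.m) :
    TwoCopyOp (Fin n → Fin q) →L[ℂ] TwoCopyOp (Fin n → Fin q) :=
  ∫ V, twoCopyConj (embed (C.fst k) (C.snd k)
    (paramProd (C.post k) θ * V.1 * paramProd (C.pre k) θ)) ∂μ k

variable {μ}

theorem VarCircuit.actsAsTwirl_meanBlock [Nontrivial (Fin q)] (hμ : ∀ k, IsTwoDesign (μ k))
    (θ : Fin p → ℝ) : ActsAsTwirl (fun k => (C.fst k, C.snd k)) (C.meanBlock μ θ) := fun k τ => by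
  rw [Fintype.card_fin]
  exact (hμ k).integral_twoCopyConj_embed_prodTensor (paramProd_mem_unitaryGroup _ θ)
    (paramProd_mem_unitaryGroup _ θ) (C.fst_ne_snd k) τ

theorem VarCircuit.integrable_and_integral_twoCopyConj_U [∀ k, IsProbabilityMeasure (μ k)]
    (θ : Fin p → ℝ) :
    Integrable (fun V => twoCopyConj (C.U V θ)) (Measure.pi μ) ∧
      ∫ V, twoCopyConj (C.U V θ) ∂Measure.pi μ =
        ((List.finRange C.m).map (C.meanBlock μ θ)).reverse.prod := by
  have hint : ∀ k, Integrable (fun V : U2 q => twoCopyConj (embed (C.fst k) (C.snd k)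
      (paramProd (C.post k) θ * V.1 * paramProd (C.pre k) θ))) (μ k) := fun k =>
    integrable_twoCopyConj ((continuous_embed _ _).comp (by fun_prop))
  simp only [VarCircuit.U, map_list_prod, List.map_reverse, List.map_ofFn, ← List.ofFn_eq_map]
  exact integrable_and_integral_pi_list_prod
    (𝔸 := TwoCopyOp (Fin n → Fin q) →L[ℂ] TwoCopyOp (Fin n → Fin q)) hint

theorem VarCircuit.integral_norm_sq_expVal [NeZero q] [∀ k, IsProbabilityMeasure (μ k)]
    (θ : Fin p → ℝ) (O : QuditOp n q) :
    ((∫ V, ‖C.expVal V θ O‖ ^ 2 ∂Measure.pi μ : ℝ) : ℂ) =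
      ((O ⊗ₖ Oᴴ) * ((List.finRange C.m).map (C.meanBlock μ θ)).reverse.prod
        (prodTensor fun _ => Matrix.single (0, 0) (0, 0) 1)).trace := by
  obtain ⟨hint, heq⟩ := C.integrable_and_integral_twoCopyConj_U (μ := μ) θ
  rw [← heq, ContinuousLinearMap.integral_apply hint, prodTensor_single, ← integral_complex_ofReal]
  simp only [VarCircuit.expVal, norm_sq_conj_apply_eq_trace]
  exact (LinearMap.toContinuousLinearMap (Matrix.traceLinearMap _ ℂ ℂ ∘ₗ
    LinearMap.mulLeft ℂ (O ⊗ₖ Oᴴ))).integral_comp_comm (hint.apply_continuousLinearMap _)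

end Circuit

section Moment

variable {n q p : ℕ} [NeZero q] (C : VarCircuit n q p) {μ : Fin C.m → Measure (U2 q)}
  {M : Fin (q ^ 2) → Matrix (Fin q) (Fin q) ℂ} {r : ℕ}

theorem VarCircuit.reverse_prod_meanBlock_single [Nontrivial (Fin q)]
    (hμ : ∀ k, IsTwoDesign (μ k)) (θ : Fin p → ℝ) :
    ((List.finRange C.m).map (C.meanBlock μ θ)).reverse.prod
        (prodTensor fun _ => Matrix.single (0, 0) (0, 0) 1) =
      ((q * (q + 1) : ℂ) ^ n)⁻¹ • ∑ γ : Fin n → Bool,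
        ((List.finRange C.m).map (C.meanBlock μ θ)).reverse.prod (prodTensor (copyPerm ∘ γ)) := by
  have hcontract : ∀ s, contract s (Matrix.single (0, 0) (0, 0) 1 : TwoCopyOp (Fin q)) =
      contract s ((q * (q + 1) : ℂ)⁻¹ • ∑ t, (copyPerm t : TwoCopyOp (Fin q))) := fun s => by
    have hq : (q : ℂ) ≠ 0 := NeZero.ne _
    have hq' : (q : ℂ) + 1 ≠ 0 := Nat.cast_add_one_ne_zero q
    rw [contract_single, map_smul, map_sum, Fintype.sum_bool, contract_copyPerm, contract_copyPerm,
      Fintype.card_fin]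
    cases s <;> simp <;> field_simp
    ring
  rw [(C.actsAsTwirl_meanBlock hμ θ).reverse_prod_apply_congr _ (fun s _ => hcontract s)
    fun i hi => ?_, prodTensor_smul_sum, map_smul, map_sum, Fintype.card_fin, inv_pow]
  · rfl
  · obtain ⟨k, hk⟩ := C.covers i
    exact absurd hk (not_or.mpr (hi k (List.mem_finRange k)))

theorem VarCircuit.integral_norm_sq_expVal_tensorOp [Nontrivial (Fin q)]
    (hμ : ∀ k, IsTwoDesign (μ k)) (hM : IsOperatorBasis M) (x : Fin n → Fin (q ^ 2))
    (θ : Fin p → ℝ) :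
    ∫ V, ‖C.expVal V θ (tensorOp M x)‖ ^ 2 ∂Measure.pi μ =
      (((q : ℝ) * (q + 1)) ^ n)⁻¹ * ∑ γ, transfer ((q : ℝ) / ((q : ℝ) ^ 2 + 1)) C.pairs
        (observableWeight (q : ℝ) (Finset.univ.filter fun i => x i ≠ 0)) γ := by
  have := fun k => (hμ k).isProbabilityMeasure
  have htransfer := (C.actsAsTwirl_meanBlock hμ θ).map_reverse_prod_apply (List.finRange C.m)
    (Matrix.traceLinearMap _ ℂ ℂ ∘ₗ LinearMap.mulLeft ℂ (tensorOp M x ⊗ₖ (tensorOp M x)ᴴ))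
    (hM.trace_tensorOp_mul_prodTensor_copyPerm x)
  simp only [LinearMap.comp_apply, LinearMap.mulLeft_apply, Matrix.traceLinearMap_apply,
    Fintype.card_fin] at htransfer
  rw [← Complex.ofReal_inj, C.integral_norm_sq_expVal, C.reverse_prod_meanBlock_single hμ,
    Matrix.mul_smul, Matrix.trace_smul, Finset.mul_sum, Matrix.trace_sum]
  simp only [htransfer, Architecture.pairs]
  push_cast
  rfl

theorem VarCircuit.integral_norm_sq_expVal_tensorOp_le [Nontrivial (Fin q)]
    (hμ : ∀ k, IsTwoDesign (μ k)) (hM : IsOperatorBasis M) (hr : C.IsRegularlyConnected r)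
    {x : Fin n → Fin (q ^ 2)} (hx : x ≠ 0) (θ : Fin p → ℝ) :
    ∫ V, ‖C.expVal V θ (tensorOp M x)‖ ^ 2 ∂Measure.pi μ ≤
      (2 * (q : ℝ) / (q + 1)) ^ n * (2 * (q : ℝ) / ((q : ℝ) ^ 2 + 1)) ^ (C.d / r) *
        ((q : ℝ) ^ hammingNorm x)⁻¹ + ((q : ℝ) ^ n + 1)⁻¹ := by
  have hq : (1 : ℝ) ≤ q := Nat.one_le_cast.mpr (NeZero.one_le)
  have hκ : 2 * ((q : ℝ) / ((q : ℝ) ^ 2 + 1)) ≤ 1 := by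
    rw [← mul_div_assoc, div_le_one (by positivity)]
    nlinarith [sq_nonneg ((q : ℝ) - 1)]
  have hpairs : ∀ e ∈ C.pairs, e.1 ≠ e.2 := by
    simpa [Architecture.pairs] using C.fst_ne_snd
  have hsupport : (Finset.univ.filter fun i => x i ≠ 0).Nonempty :=
    Finset.filter_nonempty_iff.mpr (by simpa using Function.ne_iff.mp hx)
  have hbound := sum_transfer_observableWeight_le hq hpairs
    (hr.transfer_indicator_nonconst_le (by positivity) hκ) hsupport
  rw [C.integral_norm_sq_expVal_tensorOp hμ hM]
  simpa only [Fintype.card_fin, ← mul_div_assoc, hammingNorm] using hbound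

instance (q : ℕ) : SecondCountableTopology (U2 q) :=
  have : SecondCountableTopology (TwoQuditOp q) :=
    inferInstanceAs (SecondCountableTopology (Fin q × Fin q → Fin q × Fin q → ℂ))
  TopologicalSpace.Subtype.secondCountableTopology _

theorem VarCircuit.continuous_expVal (O : QuditOp n q) :
    Continuous fun v : (Fin C.m → U2 q) × (Fin p → ℝ) => C.expVal v.1 v.2 O := by
  have hU : Continuous fun v : (Fin C.m → U2 q) × (Fin p → ℝ) => C.U v.1 v.2 := by
    unfold VarCircuit.U
    simp only [List.ofFn_eq_map, ← List.map_reverse]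
    refine continuous_list_prod _ fun k _ => (continuous_embed _ _).comp ?_
    have hpost := (continuous_paramProd (C.post k)).comp
      (continuous_snd (X := Fin C.m → U2 q))
    have hpre := (continuous_paramProd (C.pre k)).comp
      (continuous_snd (X := Fin C.m → U2 q))
    fun_prop
  exact ((hU.matrix_conjTranspose.matrix_mul continuous_const).matrix_mul hU).matrix_elem _ _

theorem VarCircuit.g_le_of_forall [∀ k, IsProbabilityMeasure (μ k)] {x : Fin n → Fin (q ^ 2)}
    {b : ℝ} (hb : ∀ θ, ∫ V, ‖C.expVal V θ (tensorOp M x)‖ ^ 2 ∂Measure.pi μ ≤ b) :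
    C.g μ M x ≤ b := by
  set K := Set.Icc (0 : Fin p → ℝ) (fun _ => 2 * Real.pi) with hK
  have hKc : IsCompact K := isCompact_Icc
  have hvol : volume K ≠ 0 := by
    simp [hK, Real.volume_Icc_pi, Real.pi_pos]
  have hcont : Continuous fun v : (Fin C.m → U2 q) × (Fin p → ℝ) =>
      ‖C.expVal v.1 v.2 (tensorOp M x)‖ ^ 2 := (C.continuous_expVal _).norm.pow 2
  have hint : Integrable (fun v : (Fin C.m → U2 q) × (Fin p → ℝ) =>
      ‖C.expVal v.1 v.2 (tensorOp M x)‖ ^ 2) ((Measure.pi μ).prod (volume.restrict K)) := by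
    have h := hcont.continuousOn.integrableOn_compact (μ := (Measure.pi μ).prod volume)
      (isCompact_univ.prod hKc)
    rwa [IntegrableOn, ← Measure.prod_restrict, Measure.restrict_univ] at h
  have hswap : C.g μ M x =
      ⨍ θ in K, ∫ V, ‖C.expVal V θ (tensorOp M x)‖ ^ 2 ∂Measure.pi μ := by
    simp only [VarCircuit.g, setAverage_eq, integral_smul, ← hK]
    rw [integral_integral_swap hint]
  rw [hswap]
  exact (convex_Iic b).set_average_mem isClosed_Iic hvol hKc.measure_ne_top
    (Filter.Eventually.of_forall hb) hint.integral_prod_right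

end Moment

section Asymptotics

variable {q : ℕ}

theorem two_mul_div_add_one_le (hq : 2 ≤ q) : 2 * (q : ℝ) / (q + 1) ≤ q := by
  have hq' : (2 : ℝ) ≤ q := by exact_mod_cast hq
  rw [div_le_iff₀ (by positivity)]
  nlinarith

-- The worst case is `q = 2`, where the claim reads `4 / 5 ≤ 2 ^ (-1 / 4)` and `hlinear` is sharp.
theorem two_mul_div_sq_add_one_le_rpow (hq : 2 ≤ q) :
    2 * (q : ℝ) / ((q : ℝ) ^ 2 + 1) ≤ (q : ℝ) ^ (-(1 / 4) : ℝ) := by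
  have hq' : (2 : ℝ) ≤ q := by exact_mod_cast hq
  have hq0 : (0 : ℝ) < q := by linarith
  have hpow : ((q : ℝ) ^ (-(1 / 4) : ℝ)) ^ 4 = (q : ℝ)⁻¹ := by
    rw [← Real.rpow_natCast, ← Real.rpow_mul hq0.le, ← Real.rpow_neg_one]
    norm_num
  refine le_of_pow_le_pow_left₀ four_ne_zero (by positivity) ?_
  rw [hpow, div_pow, div_le_iff₀ (by positivity), inv_mul_eq_div, le_div_iff₀ hq0]
  have hlinear : 5 / 2 * (q : ℝ) ≤ (q : ℝ) ^ 2 + 1 := by nlinarith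
  have hcubic : 64 / 25 * (q : ℝ) ^ 3 ≤ ((q : ℝ) ^ 2 + 1) ^ 2 := by
    nlinarith [sq_nonneg ((q : ℝ) * (q - 32 / 25)), sq_nonneg (q : ℝ)]
  calc (2 * (q : ℝ)) ^ 4 * q = (5 / 2 * (q : ℝ)) ^ 2 * (64 / 25 * (q : ℝ) ^ 3) := by ring
    _ ≤ ((q : ℝ) ^ 2 + 1) ^ 2 * ((q : ℝ) ^ 2 + 1) ^ 2 := by gcongr
    _ = _ := by ring

theorem pow_mul_pow_div_le_rpow {d r n : ℕ} (hq : 2 ≤ q) (hr : 0 < r) (hn : 0 < n) :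
    (2 * (q : ℝ) / (q + 1)) ^ n * (2 * (q : ℝ) / ((q : ℝ) ^ 2 + 1)) ^ (d / r) ≤
      (q : ℝ) ^ (-(1 / 4 * (((d : ℝ) - 5 * (r * n)) / r))) := by
  have hq1 : (1 : ℝ) ≤ q := by exact_mod_cast (by omega : 1 ≤ q)
  have hq0 : (0 : ℝ) < q := by linarith
  have hr0 : (0 : ℝ) < r := by exact_mod_cast hr
  have hn1 : (1 : ℝ) ≤ n := by exact_mod_cast hn
  have hfloor : (d : ℝ) / r < (d / r : ℕ) + 1 := by
    rw [div_lt_iff₀ hr0]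
    exact_mod_cast Nat.lt_mul_of_div_lt (Nat.lt_succ_self _) hr
  calc _ ≤ (q : ℝ) ^ n * ((q : ℝ) ^ (-(1 / 4) : ℝ)) ^ (d / r) := by
        gcongr
        · exact two_mul_div_add_one_le hq
        · exact two_mul_div_sq_add_one_le_rpow hq
    _ = (q : ℝ) ^ ((n : ℝ) + -(1 / 4) * (d / r : ℕ)) := by
        rw [Real.rpow_add hq0, Real.rpow_natCast, Real.rpow_mul hq0.le, Real.rpow_natCast]
    _ ≤ _ := by
        refine Real.rpow_le_rpow_of_exponent_le hq1 ?_
        have hshift : ((d : ℝ) - 5 * (r * n)) / r = d / r - 5 * n := by field_simp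
        rw [hshift]
        linarith

theorem two_le_of_ne_zero [NeZero q] {n : ℕ} {x : Fin n → Fin (q ^ 2)} (hx : x ≠ 0) : 2 ≤ q := by
  by_contra! hq
  obtain rfl : q = 1 := by have := NeZero.one_le (n := q); omega
  exact hx (funext fun i => Fin.subsingleton_one.elim (x i) 0)

end Asymptotics

end HEA

end

theorem corollary3_general {n q p r : ℕ} [NeZero q] (C : HEA.VarCircuit n q p)
    {μ : Fin C.m → Measure (HEA.U2 q)} {M : Fin (q ^ 2) → Matrix (Fin q) (Fin q) ℂ}
    {x : Fin n → Fin (q ^ 2)} (hμ : ∀ k, HEA.IsTwoDesign (μ k)) (hM : HEA.IsOperatorBasis M)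
    (hr : C.IsRegularlyConnected r) (hx : x ≠ 0) (θ : Fin p → ℝ) :
    ∫ V, ‖C.expVal V θ (HEA.tensorOp M x)‖ ^ 2 ∂Measure.pi μ ≤
        (2 * (q : ℝ) / (q + 1)) ^ n * (2 * (q : ℝ) / ((q : ℝ) ^ 2 + 1)) ^ (C.d / r) *
          (q : ℝ) ^ (-(hammingNorm x : ℝ)) + ((q : ℝ) ^ n + 1)⁻¹ ∧
      ∫ V, ‖C.expVal V θ (HEA.tensorOp M x)‖ ^ 2 ∂Measure.pi μ ≤
        (q : ℝ) ^ (-(n : ℝ)) +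
          (q : ℝ) ^ (-(1 / 4 * ((C.d - 5 * (r * n)) / r)) - (hammingNorm x : ℝ)) := by
  have hq : 2 ≤ q := HEA.two_le_of_ne_zero hx
  have hq0 : (0 : ℝ) < q := Nat.cast_pos.mpr (by omega)
  have := Fin.nontrivial_iff_two_le.mpr hq
  obtain ⟨i, -⟩ := Function.ne_iff.mp hx
  have hbound := C.integral_norm_sq_expVal_tensorOp_le hμ hM hr hx θ
  rw [← Real.rpow_natCast _ (hammingNorm x), ← Real.rpow_neg hq0.le] at hbound
  refine ⟨hbound, hbound.trans ?_⟩
  rw [add_comm, sub_eq_add_neg, Real.rpow_add hq0, Real.rpow_neg hq0.le n, Real.rpow_natCast]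
  gcongr
  · linarith
  · exact HEA.pow_mul_pow_div_le_rpow hq (hr.pos i.pos) i.pos

theorem corollary3 :
    (∀ (n q p r : ℕ) [NeZero q] (_ : 2 ≤ q) (C : HEA.VarCircuit n q p)
        (μ : Fin C.m → MeasureTheory.Measure (HEA.U2 q))
        (M : Fin (q ^ 2) → Matrix (Fin q) (Fin q) ℂ) (x : Fin n → Fin (q ^ 2)),
        (∀ k, HEA.IsTwoDesign (μ k)) → HEA.IsOperatorBasis M →
        C.IsRegularlyConnected r → x ≠ 0 →
        C.g μ M x ≤
          (2 * (q : ℝ) / (q + 1)) ^ n * (2 * (q : ℝ) / ((q : ℝ) ^ 2 + 1)) ^ (C.d / r) *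
              (q : ℝ) ^ (-(hammingNorm x : ℝ)) + ((q : ℝ) ^ n + 1)⁻¹) ∧
    (∃ a b : ℝ, 0 < a ∧ 0 < b ∧
      ∀ (n q p r : ℕ) [NeZero q] (_ : 2 ≤ q) (C : HEA.VarCircuit n q p)
        (μ : Fin C.m → MeasureTheory.Measure (HEA.U2 q))
        (M : Fin (q ^ 2) → Matrix (Fin q) (Fin q) ℂ) (x : Fin n → Fin (q ^ 2)),
        (∀ k, HEA.IsTwoDesign (μ k)) → HEA.IsOperatorBasis M →
        C.IsRegularlyConnected r → x ≠ 0 →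
        a * (r * n) < C.d →
        C.g μ M x ≤
          (q : ℝ) ^ (-(n : ℝ)) +
            (q : ℝ) ^ (-(b * ((C.d - a * (r * n)) / r)) - (hammingNorm x : ℝ))) := by
  refine ⟨fun n q p r _ _ C μ M x hμ hM hr hx => ?_, 5, 1 / 4, by norm_num, by norm_num,
    fun n q p r _ _ C μ M x hμ hM hr hx _ => ?_⟩ <;>
  have := fun k => (hμ k).isProbabilityMeasure
  · exact C.g_le_of_forall fun θ => (corollary3_general C hμ hM hr hx θ).1
  · exact C.g_le_of_forall fun θ => (corollary3_general C hμ hM hr hx θ).2
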